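/- Let $m,n\ge 0$ be integers. For $q:\mathbb{R}^n\to(-\infty,+\infty]$ closed (lower semicontinuous), proper and convex, put $$\mathrm{Prox}_q(x)=\arg\min_{y}\{q(y)+\tfrac12\|y-x\|^2\},\qquad \partial q(x)=\{v : q(z)\ge q(x)+\langle v,z-x\rangle\ \text{for all } z\}.$$ Call $q$ *piecewise linear-quadratic* if $\{q<\infty\}$ is a union of finitely many polyhedral sets (finite intersections of closed half-spaces), on each of which $q(x)=\tfrac12\langle x,Qx\rangle+\langle a,x\rangle+\alpha$ for some symmetric matrix $Q$, vector $a$ and scalar $\alpha$. Norms are Euclidean, $\mathrm{dist}$ is the Euclidean distance to a set, and $\mathrm{dist}(0,\emptyset)=+\infty$. Let $A\in\mathbb{R}^{m\times n}$, $c\in\mathbb{R}^n$, $\lambda>0$, let $h:\mathbb{R}^m\to\mathbb{R}$ be convex and twice continuously differentiable, and let $p:\mathbb{R}^n\to(-\infty,+\infty]$ be closed, proper and convex. Put $$\Phi(x)=h(Ax)-\langle c,x\rangle,\quad f(x)=\Phi(x)+\lambda p(x),\quad \Omega_\lambda=\arg\min f,\quad R_\lambda(x)=x-\mathrm{Prox}_{\lambda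 p}(x-\nabla\Phi(x)),$$ and assume that $\Omega_\lambda$ is nonempty and compact. Suppose that $p$ is piecewise linear-quadratic and that $h$ is strongly convex on every compact convex subset of $\mathbb{R}^m$ (with a modulus $\mu>0$ that may depend on the subset). Then: (a) for every real $\xi\ge\inf f$ there are $\kappa,\varepsilon>0$ such that $$\mathrm{dist}(x,\Omega_\lambda)\le\kappa\,\|R_\lambda(x)\|\quad\text{for all } x\in\mathbb{R}^n \text{ with } f(x)\le\xi \text{ and } \|R_\lambda(x)\|\le\varepsilon;$$ (b) for every $r>0$ there is $\kappa>0$ such that $$\mathrm{dist}(x,\Omega_\lambda)\le\kappa\,\mathrm{dist}(0,\partial f(x))\quad\text{for all } x\in\mathbb{R}^n\text{ with } \mathrm{dist}(x,\Omega_\lambda)\le r.$$ Moreover, the following satisfy these assumptions on $h$ and on $p$, respectively. (c) The functions $h(y)=\sum_{i=1}^m (y_i-b_i)^2/2$ with $b\in\mathbb{R}^m$, and $h(y)=\sum_{i=1}^m\log(1+\exp(-b_iy_i))$ with $b\in\{-1,1\}^m$, are convex, twice continuously differentiable, and strongly convex on every compact convex subset of $\mathbb{R}^m$. (d) The weighted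 exclusive lasso regularizer $x\mapsto\sum_{j=1}^l\big(\sum_{i\in g_j}|w_ix_i|\big)^2$, with weights $w_i>0$ and pairwise disjoint groups $g_1,\dots,g_l$ covering $\{1,\dots,n\}$, is closed, proper, convex and piecewise linear-quadratic. -/

import Mathlib

open scoped RealInnerProductSpace

noncomputable section

/-- Subdifferential of an extended-real-valued function, in the sense of convex analysis. At a point
where a proper function takes the value `⊤` it is empty. -/
def subdifferential {E : Type*} [NormedAddCommGroup E] [InnerProductSpace ℝ E]
    (q : E → EReal) (x : E) : Set E :=
  {v | ∀ z, q x + ((⟪v, z - x⟫ : ℝ) : EReal) ≤ q z}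

/-- The set of global minimizers of an extended-real-valued function. -/
def minimizers {E : Type*} (q : E → EReal) : Set E :=
  {x | ∀ z, q x ≤ q z}

/-- `q : E → (-∞, +∞]` is closed (lower semicontinuous), proper, and convex (convex epigraph). -/
structure IsClosedProperConvex {E : Type*} [NormedAddCommGroup E] [InnerProductSpace ℝ E]
    (q : E → EReal) : Prop where
  ne_bot : ∀ x, q x ≠ ⊥
  exists_ne_top : ∃ x, q x ≠ ⊤
  closed : LowerSemicontinuous q
  convex : Convex ℝ {z : E × ℝ | q z.1 ≤ (z.2 : EReal)}

/-- The proximal mapping: `prox q x` is the minimizer over `y` of `q y + ‖y - x‖² / 2`, which exists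
and is unique when `q` is closed, proper and convex. -/
def prox {E : Type*} [NormedAddCommGroup E] [InnerProductSpace ℝ E]
    (q : E → EReal) (x : E) : E :=
  Classical.epsilon fun y => y ∈ minimizers fun u => q u + ((‖u - x‖ ^ 2 / 2 : ℝ) : EReal)

/-- A polyhedral set: the intersection of finitely many closed half-spaces. -/
def IsPolyhedral {E : Type*} [NormedAddCommGroup E] [InnerProductSpace ℝ E] (S : Set E) : Prop :=
  ∃ (k : ℕ) (a : Fin k → E) (β : Fin k → ℝ), S = {x | ∀ i, ⟪a i, x⟫ ≤ β i}

/-- Piecewise linear-quadratic function: its effective domain is a union of finitely many polyhedral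
sets, relative to each of which it has the form `⟪x, Q x⟫ / 2 + ⟪a, x⟫ + α`, `Q` symmetric. -/
def IsPiecewiseLinearQuadratic {n : ℕ} (q : EuclideanSpace ℝ (Fin n) → EReal) : Prop :=
  ∃ (N : ℕ) (S : Fin N → Set (EuclideanSpace ℝ (Fin n))),
    (∀ i, IsPolyhedral (S i)) ∧ {x | q x < ⊤} = ⋃ i, S i ∧
    ∀ i, ∃ (Q : Matrix (Fin n) (Fin n) ℝ) (a : EuclideanSpace ℝ (Fin n)) (α : ℝ), Q.IsSymm ∧
      ∀ x ∈ S i, q x = ((⟪x, Q.toEuclideanLin x⟫ / 2 + ⟪a, x⟫ + α : ℝ) : EReal)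

/-- Strong convexity on every compact convex set (the modulus may depend on the set). -/
def StronglyConvexOnCompacts {m : ℕ} (h : EuclideanSpace ℝ (Fin m) → ℝ) : Prop :=
  ∀ K : Set (EuclideanSpace ℝ (Fin m)), IsCompact K → Convex ℝ K →
    ∃ μ : ℝ, 0 < μ ∧ StrongConvexOn K μ h

/-- The smooth part `x ↦ h (A x) - ⟨c, x⟩` of the objective. -/
def smoothPart {m n : ℕ} (A : Matrix (Fin m) (Fin n) ℝ) (c : EuclideanSpace ℝ (Fin n))
    (h : EuclideanSpace ℝ (Fin m) → ℝ) (x : EuclideanSpace ℝ (Fin n)) : ℝ :=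
  h (A.toEuclideanLin x) - ⟪c, x⟫

/-- The objective `f x = h (A x) - ⟨c, x⟩ + lam * p x`. -/
def objective {m n : ℕ} (A : Matrix (Fin m) (Fin n) ℝ) (c : EuclideanSpace ℝ (Fin n))
    (h : EuclideanSpace ℝ (Fin m) → ℝ) (p : EuclideanSpace ℝ (Fin n) → EReal) (lam : ℝ)
    (x : EuclideanSpace ℝ (Fin n)) : EReal :=
  ((smoothPart A c h x : ℝ) : EReal) + (lam : EReal) * p x

/-- The proximal residual `R x = x - Prox_{lam p} (x - ∇Φ x)`, with `Φ` the smooth part. -/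
def proxResidual {m n : ℕ} (A : Matrix (Fin m) (Fin n) ℝ) (c : EuclideanSpace ℝ (Fin n))
    (h : EuclideanSpace ℝ (Fin m) → ℝ) (p : EuclideanSpace ℝ (Fin n) → EReal) (lam : ℝ)
    (x : EuclideanSpace ℝ (Fin n)) : EuclideanSpace ℝ (Fin n) :=
  x - prox (fun u => (lam : EReal) * p u) (x - gradient (smoothPart A c h) x)

/-- The error bound condition for `∂f`: on every set `{x | dist(x, Ω) ≤ r}`, `Ω = argmin f`,
one has `dist(x, Ω) ≤ κ dist(0, ∂f(x))`, where the distance to the empty set is `∞`. -/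
def ErrorBoundCondition {E : Type*} [NormedAddCommGroup E] [InnerProductSpace ℝ E]
    (f : E → EReal) : Prop :=
  ∀ r : ℝ, 0 < r → ∃ κ : ℝ, 0 < κ ∧ ∀ x : E,
    Metric.infEDist x (minimizers f) ≤ ENNReal.ofReal r →
    Metric.infEDist x (minimizers f) ≤
      ENNReal.ofReal κ * Metric.infEDist 0 (subdifferential f x)

/-- The linear regression loss. -/
def linearLoss {m : ℕ} (b : Fin m → ℝ) (y : EuclideanSpace ℝ (Fin m)) : ℝ :=
  ∑ i, (y i - b i) ^ 2 / 2

/-- The logistic regression loss. -/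
def logisticLoss {m : ℕ} (b : Fin m → ℝ) (y : EuclideanSpace ℝ (Fin m)) : ℝ :=
  ∑ i, Real.log (1 + Real.exp (-(b i * y i)))

/-- The weighted exclusive lasso regularizer with groups `g j` and weights `w`. -/
def exclusiveLasso {n l : ℕ} (g : Fin l → Finset (Fin n)) (w : Fin n → ℝ)
    (x : EuclideanSpace ℝ (Fin n)) : ℝ :=
  ∑ j, (∑ i ∈ g j, |w i * x i|) ^ 2

end

/-! Both error bounds follow from quadratic growth: `κ * dist(x, Ω)² ≤ f x - min f` on each set
`dist(x, Ω) ≤ r`. Let a polyhedral piece meet `Ω` at `y`. Strong convexity of `h` on a ball gives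
`Φ` a curvature of at least `μ‖A(x - y)‖²`, so on bounded sets `f x - f y` dominates `⟨g, x - y⟩ +
⟨x - y, T(x - y)⟩ / 2` with `T = Q + μ A*A`. Both terms are nonnegative on the piece. Where both
vanish, `A(x - y) = 0`, so `Φ` is affine between the two points and `f x = f y`: such points are
minimizers. The form of `T` is a sum of squares of linear forms on the directions of the piece, so
these points contain the solutions of a linear system, and Hoffman's bound controls the distance to
them by a residual whose square is at most a multiple of the quadratic. A piece missing `Ω` has a
positive gap on its bounded part. For (b), the subgradient inequality at a nearest minimizer gives
`κ d² ≤ ‖v‖ d`. For (a), the same argument is applied at the proximal point `y`, where `x - y + ∇Φ y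
- ∇Φ x` is a subgradient of norm at most `(1 + L)‖x - y‖`; growth and convexity keep the sublevel
set within bounded distance of `Ω`. -/

/-! ### Polyhedral cones, Farkas' lemma and Hoffman's bound. -/

/-- Conic Carathéodory: a nonnegative combination of vectors is a nonnegative combination of a
linearly independent subfamily. -/
theorem exists_linearIndependent_nonneg_combination {E ι : Type*} [AddCommGroup E] [Module ℝ E]
    [DecidableEq ι] (a : ι → E) (s : Finset ι) (c : ι → ℝ) (hc : ∀ i ∈ s, 0 ≤ c i) :
    ∃ t ⊆ s, LinearIndependent ℝ (fun i : t => a i) ∧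
      ∃ d : ι → ℝ, (∀ i ∈ t, 0 ≤ d i) ∧ ∑ i ∈ s, c i • a i = ∑ i ∈ t, d i • a i := by
  induction s using Finset.strongInduction generalizing c with
  | H s ih =>
  by_cases hli : LinearIndependent ℝ (fun i : s => a i)
  · exact ⟨s, subset_rfl, hli, c, hc, rfl⟩
  have hdep : ∃ g : ι → ℝ, ∑ i ∈ s, g i • a i = 0 ∧ ∃ i ∈ s, 0 < g i := by
    have h1 : ¬ LinearIndepOn ℝ a (s : Set ι) := hli
    rw [linearIndepOn_finset_iff] at h1
    push Not at h1
    obtain ⟨g, hg, i, hi, hgi⟩ := h1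
    rcases lt_or_gt_of_ne hgi with h | h
    · refine ⟨fun i => - g i, ?_, i, hi, by simpa using h⟩
      simp [neg_smul, Finset.sum_neg_distrib, hg]
    · exact ⟨g, hg, i, hi, h⟩
  obtain ⟨g, hg, i₁, hi₁, hgi₁⟩ := hdep
  -- The minimal ratio is the largest `θ` keeping `c - θ g` nonnegative; it annihilates the
  -- coefficient at `i₀`, which can then be dropped.
  obtain ⟨i₀, hi₀, hmin⟩ := Finset.exists_min_image (s.filter fun i => 0 < g i)
    (fun i => c i / g i) ⟨i₁, by simp [hi₁, hgi₁]⟩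
  rw [Finset.mem_filter] at hi₀
  set θ := c i₀ / g i₀ with hθ
  have hθ0 : 0 ≤ θ := div_nonneg (hc _ hi₀.1) hi₀.2.le
  have hnn : ∀ i ∈ s, 0 ≤ c i - θ * g i := by
    intro i hi
    by_cases hgi : 0 < g i
    · have := hmin i (by simp [hi, hgi])
      rw [le_div_iff₀ hgi] at this
      linarith
    · have := mul_nonneg hθ0 (neg_nonneg.2 (not_lt.1 hgi))
      have := hc i hi
      linarith
  have hz : c i₀ - θ * g i₀ = 0 := by
    rw [hθ, div_mul_cancel₀ _ hi₀.2.ne', sub_self]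
  obtain ⟨t, ht, hti, d, hd, hsum⟩ := ih (s.erase i₀) (Finset.erase_ssubset hi₀.1)
    (fun i => c i - θ * g i) fun i hi => hnn i (Finset.mem_of_mem_erase hi)
  refine ⟨t, ht.trans (Finset.erase_subset _ _), hti, d, hd, ?_⟩
  rw [← hsum, ← Finset.add_sum_erase s _ hi₀.1]
  have h2 : ∑ i ∈ s, (c i - θ * g i) • a i = ∑ i ∈ s, c i • a i := by
    simp only [sub_smul, mul_smul, Finset.sum_sub_distrib, ← Finset.smul_sum, hg, smul_zero,
      sub_zero]
  rw [← Finset.add_sum_erase s _ hi₀.1, ← Finset.add_sum_erase s _ hi₀.1, hz, zero_smul,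
    zero_add] at h2
  exact h2.symm

section

variable {E ι : Type*} [NormedAddCommGroup E] [InnerProductSpace ℝ E]

theorem isClosed_polyhedron (a : ι → E) (β : ι → ℝ) : IsClosed {z | ∀ i, ⟪a i, z⟫ ≤ β i} := by
  simp only [Set.ofPred_forall]
  exact isClosed_iInter fun i => isClosed_le (by fun_prop) continuous_const

theorem convex_polyhedron (a : ι → E) (β : ι → ℝ) : Convex ℝ {z | ∀ i, ⟪a i, z⟫ ≤ β i} := by
  intro x hx y hy s t hs ht hst i
  rw [inner_add_right, inner_smul_right, inner_smul_right]
  have h1 := mul_le_mul_of_nonneg_left (hx i) hs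
  have h2 := mul_le_mul_of_nonneg_left (hy i) ht
  have h3 : s * β i + t * β i = β i := by rw [← add_mul, hst, one_mul]
  linarith

/-- The coefficients with respect to a linearly independent family are bounded by the vector. -/
theorem exists_coefficient_bound (a : ι → E) (t : Finset ι)
    (ht : LinearIndependent ℝ (fun i : t => a i)) :
    ∃ C : ℝ, 0 ≤ C ∧ ∀ d : ι → ℝ, ∀ i ∈ t, |d i| ≤ C * ‖∑ i ∈ t, d i • a i‖ := by
  have hker : (Fintype.linearCombination ℝ (fun i : t => a i)).ker = ⊥ :=
    LinearMap.ker_eq_bot.2 ht.fintypeLinearCombination_injective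
  obtain ⟨K, -, hK⟩ := LinearMap.exists_antilipschitzWith
    (Fintype.linearCombination ℝ (fun i : t => a i)) hker
  refine ⟨K, K.2, fun d i hi => ?_⟩
  have h := hK.le_mul_dist (fun i : t => d i) 0
  rw [map_zero, dist_zero_right, dist_zero_right, Fintype.linearCombination_apply,
    Finset.sum_coe_sort t (fun i => d i • a i)] at h
  exact (norm_le_pi_norm (fun i : t => d i) ⟨i, hi⟩).trans h

/-- The cone generated by a finite family in a finite-dimensional space is closed. -/
theorem isClosed_finset_cone [DecidableEq ι] (a : ι → E) (s : Finset ι) :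
    IsClosed {v : E | ∃ c : ι → ℝ, (∀ i ∈ s, 0 ≤ c i) ∧ v = ∑ i ∈ s, c i • a i} := by
  classical
  -- By Carathéodory the cone is a finite union of cones over independent subfamilies, each the
  -- image of a closed orthant under a closed embedding.
  have heq : {v : E | ∃ c : ι → ℝ, (∀ i ∈ s, 0 ≤ c i) ∧ v = ∑ i ∈ s, c i • a i} =
      ⋃ t ∈ s.powerset.filter (fun t : Finset ι => LinearIndependent ℝ (fun i : t => a i)),
        (Fintype.linearCombination ℝ (fun i : t => a i)) '' {c | ∀ i, 0 ≤ c i} := by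
    ext v
    simp only [Set.mem_ofPred_eq, Set.mem_iUnion, Finset.mem_filter, Finset.mem_powerset,
      Set.mem_image, exists_prop]
    constructor
    · rintro ⟨c, hc, rfl⟩
      obtain ⟨t, hts, ht, d, hd, hsum⟩ := exists_linearIndependent_nonneg_combination a s c hc
      refine ⟨t, ⟨hts, ht⟩, fun i => d i, fun i => hd i i.2, ?_⟩
      rw [Fintype.linearCombination_apply, Finset.sum_coe_sort t (fun i => d i • a i), hsum]
    · rintro ⟨t, ⟨hts, -⟩, c, hc, rfl⟩
      refine ⟨fun i => if h : i ∈ t then c ⟨i, h⟩ else 0, fun i _ => ?_, ?_⟩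
      · dsimp only
        split_ifs with h
        · exact hc _
        · exact le_rfl
      · rw [Fintype.linearCombination_apply, ← Finset.sum_subset hts, ← Finset.sum_coe_sort t]
        · exact Finset.sum_congr rfl fun i _ => by simp
        · intro i _ hi
          simp [hi]
  rw [heq]
  refine Set.Finite.isClosed_biUnion (Finset.finite_toSet _) fun t ht => ?_
  have ht' : LinearIndependent ℝ (fun i : t => a i) := (Finset.mem_filter.1 ht).2
  have hker : (Fintype.linearCombination ℝ (fun i : t => a i)).ker = ⊥ :=
    LinearMap.ker_eq_bot.2 ht'.fintypeLinearCombination_injective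
  refine (LinearMap.isClosedEmbedding_of_injective hker).isClosedMap _ ?_
  simp only [Set.ofPred_forall]
  exact isClosed_iInter fun i => isClosed_le continuous_const (continuous_apply i)

variable [FiniteDimensional ℝ E]

/-- **Farkas' lemma**. -/
theorem exists_nonneg_combination_of_forall_inner_nonpos [DecidableEq ι] (a : ι → E)
    (s : Finset ι) (v : E) (hv : ∀ y, (∀ i ∈ s, ⟪a i, y⟫ ≤ 0) → ⟪v, y⟫ ≤ 0) :
    ∃ c : ι → ℝ, (∀ i ∈ s, 0 ≤ c i) ∧ v = ∑ i ∈ s, c i • a i := by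
  by_contra hcon
  set K : Set E := {v : E | ∃ c : ι → ℝ, (∀ i ∈ s, 0 ≤ c i) ∧ v = ∑ i ∈ s, c i • a i} with hK
  have hconv : Convex ℝ K := by
    rintro _ ⟨c, hc, rfl⟩ _ ⟨d, hd, rfl⟩ α β hα hβ -
    refine ⟨fun i => α * c i + β * d i, fun i hi => ?_, ?_⟩
    · have := hc i hi
      have := hd i hi
      positivity
    · simp only [add_smul, mul_smul, Finset.sum_add_distrib, Finset.smul_sum]
  obtain ⟨f, u, hf, hu⟩ := geometric_hahn_banach_closed_point hconv (isClosed_finset_cone a s)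
    (show v ∉ K from hcon)
  have h0 : (0 : E) ∈ K := ⟨0, fun _ _ => le_rfl, by simp⟩
  have hu0 : 0 < u := by simpa using hf 0 h0
  have hy : ∀ x, ⟪x, (InnerProductSpace.toDual ℝ E).symm f⟫ = f x := fun x => by
    rw [real_inner_comm, InnerProductSpace.toDual_symm_apply]
  have := hv ((InnerProductSpace.toDual ℝ E).symm f) fun i hi => by
    rw [hy]
    by_contra! hpos
    -- If `f (a i)` were positive, this multiple of the generator would lie in the cone and attain
    -- the separating level `u`.
    have h1 := hf ((u / f (a i)) • a i) ⟨fun j => if j = i then u / f (a i) else 0, fun j _ => by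
      dsimp only
      split_ifs
      · positivity
      · exact le_rfl, by simp [ite_smul, hi]⟩
    rw [map_smul, smul_eq_mul, div_mul_cancel₀ _ hpos.ne'] at h1
    exact lt_irrefl _ h1
  rw [hy] at this
  linarith

/-- The normal cone to a polyhedron is generated by the active constraints. -/
theorem exists_active_combination [Fintype ι] [DecidableEq ι] (a : ι → E) (β : ι → ℝ) {x y : E}
    (hy : ∀ i, ⟪a i, y⟫ ≤ β i)
    (hxy : ∀ z, (∀ i, ⟪a i, z⟫ ≤ β i) → ⟪x - y, z - y⟫ ≤ 0) :
    ∃ c : ι → ℝ, (∀ i ∈ Finset.univ.filter (fun i => ⟪a i, y⟫ = β i), 0 ≤ c i) ∧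
      x - y = ∑ i ∈ Finset.univ.filter (fun i => ⟪a i, y⟫ = β i), c i • a i := by
  refine exists_nonneg_combination_of_forall_inner_nonpos a _ _ fun w hw => ?_
  -- `w` is a feasible direction at `y`: active constraints do not increase along it, and inactive
  -- ones have slack for small `t`.
  have hev : ∀ᶠ t : ℝ in nhdsWithin 0 (Set.Ioi 0), ∀ i, ⟪a i, y + t • w⟫ ≤ β i := by
    rw [Filter.eventually_all]
    intro i
    rcases (hy i).eq_or_lt with h | h
    · filter_upwards [self_mem_nhdsWithin] with t ht
      have := hw i (by simp [h])
      rw [inner_add_right, inner_smul_right, h]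
      have := mul_nonpos_of_nonneg_of_nonpos (le_of_lt ht) this
      linarith
    · refine nhdsWithin_le_nhds ?_
      have hc : Continuous fun t : ℝ => ⟪a i, y + t • w⟫ := by fun_prop
      have := hc.tendsto 0
      simp only [zero_smul, add_zero] at this
      filter_upwards [this.eventually (gt_mem_nhds h)] with t ht using ht.le
  obtain ⟨t, ht, ht0⟩ := (hev.and self_mem_nhdsWithin).exists
  have h := hxy _ ht
  rw [add_sub_cancel_left, inner_smul_right] at h
  exact nonpos_of_mul_nonpos_right h ht0

/-- **Hoffman's error bound** for systems of linear inequalities. -/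
theorem hoffman_error_bound [Fintype ι] (a : ι → E) (β : ι → ℝ)
    (hne : {z | ∀ i, ⟪a i, z⟫ ≤ β i}.Nonempty) :
    ∃ κ : ℝ, 0 ≤ κ ∧ ∀ x, Metric.infDist x {z | ∀ i, ⟪a i, z⟫ ≤ β i} ≤
      κ * ∑ i, max 0 (⟪a i, x⟫ - β i) := by
  classical
  -- One constant for each independent subfamily; their finite sum serves every `x`, whichever
  -- subfamily Carathéodory selects.
  have hC : ∀ t : Finset ι, ∃ C : ℝ, 0 ≤ C ∧ (LinearIndependent ℝ (fun i : t => a i) →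
      ∀ d : ι → ℝ, ∀ i ∈ t, |d i| ≤ C * ‖∑ i ∈ t, d i • a i‖) := by
    intro t
    by_cases ht : LinearIndependent ℝ (fun i : t => a i)
    · obtain ⟨C, hC0, hC⟩ := exists_coefficient_bound a t ht
      exact ⟨C, hC0, fun _ => hC⟩
    · exact ⟨0, le_rfl, fun h => absurd h ht⟩
  choose C hC0 hC using hC
  have hκ : 0 ≤ ∑ t, C t := Finset.sum_nonneg fun t _ => hC0 t
  refine ⟨∑ t, C t, hκ, fun x => ?_⟩
  obtain ⟨y, hy, hxy⟩ := (isClosed_polyhedron a β).exists_infDist_eq_dist hne x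
  have hvar : ∀ z ∈ {z | ∀ i, ⟪a i, z⟫ ≤ β i}, ⟪x - y, z - y⟫ ≤ 0 := by
    rw [← norm_eq_iInf_iff_real_inner_le_zero (convex_polyhedron a β) hy, ← dist_eq_norm, ← hxy,
      Metric.infDist_eq_iInf]
    simp only [dist_eq_norm]
  obtain ⟨c, hc, hsum⟩ := exists_active_combination a β hy hvar
  obtain ⟨t, hts, hti, d, hd, hsum'⟩ := exists_linearIndependent_nonneg_combination a _ c hc
  rw [← hsum] at hsum'
  have hle : ∀ i ∈ t, d i ≤ (∑ t, C t) * ‖x - y‖ := fun i hi => by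
    have h1 := hC t hti d i hi
    rw [← hsum'] at h1
    exact (le_abs_self _).trans (h1.trans (mul_le_mul_of_nonneg_right
      (Finset.single_le_sum (fun t _ => hC0 t) (Finset.mem_univ t)) (norm_nonneg _)))
  -- The selected constraints are active at the projection `y`, so pairing `x - y = ∑ d i • a i`
  -- with itself produces exactly their residuals at `x`.
  have hsq : ‖x - y‖ * ‖x - y‖ ≤ ((∑ t, C t) * ∑ i, max 0 (⟪a i, x⟫ - β i)) * ‖x - y‖ := by
    calc ‖x - y‖ * ‖x - y‖ = ⟪∑ i ∈ t, d i • a i, x - y⟫ := by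
          rw [← hsum', real_inner_self_eq_norm_mul_norm]
      _ = ∑ i ∈ t, d i * (⟪a i, x⟫ - β i) := by
          rw [sum_inner]
          refine Finset.sum_congr rfl fun i hi => ?_
          rw [real_inner_smul_left, inner_sub_right, (Finset.mem_filter.1 (hts hi)).2]
      _ ≤ ∑ i ∈ t, ((∑ t, C t) * ‖x - y‖) * max 0 (⟪a i, x⟫ - β i) := by
          refine Finset.sum_le_sum fun i hi => ?_
          exact (mul_le_mul_of_nonneg_left (le_max_right _ _) (hd i hi)).trans
            (mul_le_mul_of_nonneg_right (hle i hi) (le_max_left _ _))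
      _ ≤ ∑ i, ((∑ t, C t) * ‖x - y‖) * max 0 (⟪a i, x⟫ - β i) :=
          Finset.sum_le_sum_of_subset_of_nonneg (Finset.subset_univ _) fun i _ _ => by positivity
      _ = _ := by rw [← Finset.mul_sum]; ring
  rw [hxy, dist_eq_norm]
  rcases (norm_nonneg (x - y)).eq_or_lt with h | h
  · rw [← h]
    exact mul_nonneg hκ (Finset.sum_nonneg fun i _ => le_max_left _ _)
  · exact le_of_mul_le_mul_right hsq h

end

/-! ### Convex quadratics on a polyhedron. -/

/-- A quadratic form that is nonnegative on a subspace is a sum of squares there. -/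
theorem exists_sum_sq_of_nonneg_on_submodule {E : Type*} [NormedAddCommGroup E]
    [InnerProductSpace ℝ E] [FiniteDimensional ℝ E] (T : E →ₗ[ℝ] E) (hT : T.IsSymmetric)
    (L : Submodule ℝ E) (hL : ∀ d ∈ L, 0 ≤ ⟪d, T d⟫) :
    ∃ (k : ℕ) (u : Fin k → E), ∀ d ∈ L, ⟪d, T d⟫ = ∑ i, ⟪u i, d⟫ ^ 2 := by
  set P : E →ₗ[ℝ] E := L.starProjection.toLinearMap with hP
  have hPsym : ∀ x y, ⟪P x, y⟫ = ⟪x, P y⟫ := fun x y => L.starProjection_isSymmetric x y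
  have hPmem : ∀ x, P x ∈ L := fun x => by simp [hP]
  have hPid : ∀ d ∈ L, P d = d := fun d hd => L.starProjection_eq_self_iff.2 hd
  -- Compressing `T` by the projection onto `L` gives a symmetric operator, positive semidefinite on
  -- all of `E`, with the same form on `L`; it can be diagonalized.
  have hsym : (P ∘ₗ T ∘ₗ P).IsSymmetric := fun x y => by
    simp only [LinearMap.comp_apply]
    rw [hPsym, hT, hPsym]
  set e := hsym.eigenvectorBasis rfl
  set l := hsym.eigenvalues rfl
  have hel : ∀ i, (P ∘ₗ T ∘ₗ P) (e i) = l i • e i := fun i => by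
    exact hsym.apply_eigenvectorBasis rfl i
  have hl : ∀ i, 0 ≤ l i := fun i => by
    have h1 : ⟪e i, (P ∘ₗ T ∘ₗ P) (e i)⟫ = l i := by
      rw [hel, real_inner_smul_right, real_inner_self_eq_norm_sq, e.norm_eq_one]
      simp
    rw [← h1]
    simp only [LinearMap.comp_apply]
    rw [← hPsym]
    exact hL _ (hPmem _)
  refine ⟨_, fun i => √(l i) • e i, fun d hd => ?_⟩
  have h2 : ⟪d, T d⟫ = ⟪d, (P ∘ₗ T ∘ₗ P) d⟫ := by
    simp only [LinearMap.comp_apply]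
    rw [← hPsym, hPid d hd]
  rw [h2, ← e.sum_inner_mul_inner]
  refine Finset.sum_congr rfl fun i _ => ?_
  rw [← hsym, hel, real_inner_smul_left, real_inner_smul_left, mul_pow, Real.sq_sqrt (hl i),
    real_inner_comm]
  ring

/-- The multiples of differences of points of a nonempty convex set form a subspace. -/
theorem exists_submodule_eq_smul_sub {E : Type*} [AddCommGroup E] [Module ℝ E]
    {S : Set E} (hS : Convex ℝ S) (hne : S.Nonempty) :
    ∃ L : Submodule ℝ E, (∀ x ∈ S, ∀ y ∈ S, x - y ∈ L) ∧
      ∀ d ∈ L, ∃ t : ℝ, ∃ x ∈ S, ∃ y ∈ S, d = t • (x - y) := by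
  obtain ⟨x₀, hx₀⟩ := hne
  -- Swapping the two points makes the coefficient nonnegative, so that sums reduce to convex
  -- combinations.
  have hpos : ∀ t : ℝ, ∀ x ∈ S, ∀ y ∈ S,
      ∃ t' : ℝ, 0 ≤ t' ∧ ∃ x' ∈ S, ∃ y' ∈ S, t • (x - y) = t' • (x' - y') := by
    intro t x hx y hy
    rcases le_total 0 t with h | h
    · exact ⟨t, h, x, hx, y, hy, rfl⟩
    · exact ⟨-t, by linarith, y, hy, x, hx, by module⟩
  refine ⟨⟨⟨⟨{d | ∃ t : ℝ, ∃ x ∈ S, ∃ y ∈ S, d = t • (x - y)}, ?_⟩, ?_⟩, ?_⟩, ?_, fun d hd => hd⟩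
  · rintro _ _ ⟨t, x, hx, y, hy, rfl⟩ ⟨s, x', hx', y', hy', rfl⟩
    obtain ⟨t, ht, x, hx, y, hy, h1⟩ := hpos t x hx y hy
    obtain ⟨s, hs, x', hx', y', hy', h2⟩ := hpos s x' hx' y' hy'
    rw [h1, h2]
    rcases (add_nonneg ht hs).eq_or_lt with h | h
    · have ht0 : t = 0 := by linarith
      have hs0 : s = 0 := by linarith
      exact ⟨0, x₀, hx₀, x₀, hx₀, by simp [ht0, hs0]⟩
    · have hts : t / (t + s) + s / (t + s) = 1 := by field_simp
      refine ⟨t + s, _, hS hx hx' (div_nonneg ht h.le) (div_nonneg hs h.le) hts, _,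
        hS hy hy' (div_nonneg ht h.le) (div_nonneg hs h.le) hts, ?_⟩
      have e1 : (t + s) * (t / (t + s)) = t := by field_simp
      have e2 : (t + s) * (s / (t + s)) = s := by field_simp
      have e3 : ∀ v w : E, (t + s) • ((t / (t + s)) • v + (s / (t + s)) • w) = t • v + s • w :=
        fun v w => by rw [smul_add, smul_smul, smul_smul, e1, e2]
      rw [smul_sub (t + s), e3, e3]
      module
  · exact ⟨0, x₀, hx₀, x₀, hx₀, by simp⟩
  · rintro r _ ⟨t, x, hx, y, hy, rfl⟩
    exact ⟨r * t, x, hx, y, hy, by rw [smul_smul]⟩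
  · intro x hx y hy
    exact ⟨1, x, hx, y, hy, by simp⟩

/-- Quadratic growth of a convex quadratic function on the bounded part of a polyhedron, relative
to its set of minimizers. -/
theorem quadratic_growth_on_polyhedron {E ι : Type*} [NormedAddCommGroup E]
    [InnerProductSpace ℝ E] [FiniteDimensional ℝ E] [Fintype ι] (a : ι → E) (β : ι → ℝ) (T : E →ₗ[ℝ] E)
    (hT : T.IsSymmetric) (g : E) {y : E} (hy : ∀ i, ⟪a i, y⟫ ≤ β i)
    (hg : ∀ x, (∀ i, ⟪a i, x⟫ ≤ β i) → 0 ≤ ⟪g, x - y⟫)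
    (hpsd : ∀ x, (∀ i, ⟪a i, x⟫ ≤ β i) → ∀ z, (∀ i, ⟪a i, z⟫ ≤ β i) → 0 ≤ ⟪x - z, T (x - z)⟫)
    (M : ℝ) :
    ∃ κ : ℝ, 0 < κ ∧ ∀ x, (∀ i, ⟪a i, x⟫ ≤ β i) → ‖x - y‖ ≤ M →
      κ * Metric.infDist x {z | (∀ i, ⟪a i, z⟫ ≤ β i) ∧ ⟪g, z - y⟫ = 0 ∧
        ⟪z - y, T (z - y)⟫ = 0} ^ 2 ≤ ⟪g, x - y⟫ + ⟪x - y, T (x - y)⟫ / 2 := by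
  obtain ⟨L, hL1, hL2⟩ := exists_submodule_eq_smul_sub (convex_polyhedron a β) ⟨y, hy⟩
  obtain ⟨k, u, hu⟩ := exists_sum_sq_of_nonneg_on_submodule T hT L fun d hd => by
    obtain ⟨t, x, hx, z, hz, rfl⟩ := hL2 d hd
    rw [map_smul, real_inner_smul_left, real_inner_smul_right, ← mul_assoc]
    exact mul_nonneg (mul_self_nonneg t) (hpsd x hx z hz)
  -- The constraints of the polyhedron, then `⟨g, z⟩ ≤ ⟨g, y⟩`, then each equation `⟨u i, z⟩ = ⟨u i,
  -- y⟩` as two inequalities. The reverse inequality for `g` is `hg`.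
  set rows : ι ⊕ Unit ⊕ Fin k ⊕ Fin k → E :=
    Sum.elim a (Sum.elim (fun _ => g) (Sum.elim u (fun i => -u i))) with hrows
  set rhs : ι ⊕ Unit ⊕ Fin k ⊕ Fin k → ℝ := Sum.elim β (Sum.elim (fun _ => ⟪g, y⟫)
    (Sum.elim (fun i => ⟪u i, y⟫) (fun i => -⟪u i, y⟫))) with hrhs
  have hyP : y ∈ {z | ∀ i, ⟪rows i, z⟫ ≤ rhs i} := by
    rintro (i | i | i | i)
    · exact hy i
    all_goals simp [hrows, hrhs]
  obtain ⟨κ, hκ, hH⟩ := hoffman_error_bound rows rhs ⟨y, hyP⟩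
  set Z := {z | (∀ i, ⟪a i, z⟫ ≤ β i) ∧ ⟪g, z - y⟫ = 0 ∧ ⟪z - y, T (z - y)⟫ = 0} with hZ
  have hsub : {z | ∀ i, ⟪rows i, z⟫ ≤ rhs i} ⊆ Z := by
    intro z hz
    have hzS : ∀ i, ⟪a i, z⟫ ≤ β i := fun i => hz (Sum.inl i)
    refine ⟨hzS, le_antisymm ?_ (hg z hzS), ?_⟩
    · have := hz (Sum.inr (Sum.inl ()))
      simp only [hrows, hrhs, Sum.elim_inr, Sum.elim_inl] at this
      rw [inner_sub_right]
      linarith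
    · rw [hu _ (hL1 z hzS y hy)]
      refine Finset.sum_eq_zero fun i _ => ?_
      have h1 := hz (Sum.inr (Sum.inr (Sum.inl i)))
      have h2 := hz (Sum.inr (Sum.inr (Sum.inr i)))
      simp only [hrows, hrhs, Sum.elim_inr, Sum.elim_inl, inner_neg_left] at h1 h2
      rw [inner_sub_right, show ⟪u i, z⟫ = ⟪u i, y⟫ by linarith]
      simp
  -- With `γ` the linear term and `B` the sum of squares, the squared residual is at most `2γ² +
  -- 2kB`; since `γ ≤ ‖g‖|M|`, the term `γ²` is bounded linearly in `γ`. The summand `1` makes `C`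
  -- positive.
  set C : ℝ := 2 * κ ^ 2 * (‖g‖ * |M| + 2 * k) + 1 with hC
  have hC0 : 0 < C := by positivity
  refine ⟨C⁻¹, inv_pos.2 hC0, fun x hx hxM => ?_⟩
  rw [inv_mul_le_iff₀ hC0]
  set γ := ⟪g, x - y⟫ with hγ
  have hγ0 : 0 ≤ γ := hg x hx
  have hγM : γ ≤ ‖g‖ * |M| := (real_inner_le_norm _ _).trans
    (mul_le_mul_of_nonneg_left (hxM.trans (le_abs_self M)) (norm_nonneg g))
  rw [hu _ (hL1 x hx y hy)]
  set s : Fin k → ℝ := fun i => ⟪u i, x - y⟫ with hs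
  have hres : ∑ i, max 0 (⟪rows i, x⟫ - rhs i) = γ + ∑ i, |s i| := by
    rw [Fintype.sum_sum_type, Fintype.sum_sum_type, Fintype.sum_sum_type]
    simp only [hrows, hrhs, Sum.elim_inr, Sum.elim_inl, inner_neg_left, ← inner_sub_right]
    rw [Finset.sum_eq_zero fun i _ => max_eq_left (sub_nonpos.2 (hx i)), zero_add,
      ← Finset.sum_add_distrib]
    congr 1
    · simp [hγ0, ← hγ]
    · refine Finset.sum_congr rfl fun i _ => ?_
      have : -⟪u i, x⟫ - -⟪u i, y⟫ = - s i := by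
        simp only [hs, inner_sub_right]
        ring
      rw [this]
      change max 0 (s i) + max 0 (- s i) = |s i|
      rcases le_total 0 (s i) with h | h
      · rw [max_eq_right h, max_eq_left (by linarith), abs_of_nonneg h, add_zero]
      · rw [max_eq_left h, max_eq_right (by linarith), abs_of_nonpos h, zero_add]
  have hd : Metric.infDist x Z ≤ κ * (γ + ∑ i, |s i|) := by
    rw [← hres]
    exact (Metric.infDist_le_infDist_of_subset hsub ⟨y, hyP⟩).trans (hH x)
  have hA : (∑ i, |s i|) ^ 2 ≤ k * ∑ i, s i ^ 2 := by
    simpa using sq_sum_le_card_mul_sum_sq (s := Finset.univ) (f := fun i => |s i|)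
  set A := ∑ i, |s i|
  set B := ∑ i, s i ^ 2
  have hB : 0 ≤ B := Finset.sum_nonneg fun i _ => sq_nonneg _
  have h1 : Metric.infDist x Z ^ 2 ≤ κ ^ 2 * (γ + A) ^ 2 := by
    rw [← mul_pow]
    exact pow_le_pow_left₀ Metric.infDist_nonneg hd 2
  have h2 : (γ + A) ^ 2 ≤ 2 * (γ * (‖g‖ * |M|) + k * B) := by
    nlinarith [sq_nonneg (γ - A), mul_le_mul_of_nonneg_left hγM hγ0]
  have h3 : γ * (‖g‖ * |M|) + k * B ≤ (‖g‖ * |M| + 2 * k) * (γ + B / 2) := by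
    have : 0 ≤ ‖g‖ * |M| * (B / 2) := by positivity
    have : 0 ≤ 2 * (k : ℝ) * γ := by positivity
    linarith
  calc Metric.infDist x Z ^ 2 ≤ κ ^ 2 * (2 * ((‖g‖ * |M| + 2 * k) * (γ + B / 2))) :=
        h1.trans (mul_le_mul_of_nonneg_left (h2.trans (by linarith)) (sq_nonneg κ))
    _ ≤ C * (γ + B / 2) := by rw [hC]; nlinarith

/-! ### First-order inequalities. -/

/-- First-order optimality condition for the sum of a differentiable and a convex function. -/
theorem ConvexOn.sub_le_of_isMinOn_add {E : Type*} [NormedAddCommGroup E] [NormedSpace ℝ E]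
    {D : Set E} {P Ψ : E → ℝ} {Ψ' : E →L[ℝ] ℝ} {y : E} (hP : ConvexOn ℝ D P)
    (hΨ : HasFDerivAt Ψ Ψ' y) (hy : y ∈ D) (hmin : ∀ x ∈ D, Ψ y + P y ≤ Ψ x + P x) {x : E}
    (hx : x ∈ D) : P y - Ψ' (x - y) ≤ P x := by
  have hd : HasDerivAt (fun t : ℝ => Ψ (y + t • (x - y))) (Ψ' (x - y)) 0 := by
    have := (show HasFDerivAt Ψ Ψ' (y + (0 : ℝ) • (x - y)) by simpa using hΨ).comp_hasDerivAt (0 : ℝ)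
      (((hasDerivAt_id (0 : ℝ)).smul_const (x - y)).const_add y)
    simpa using! this
  have hlim := hd.tendsto_slope_zero_right
  have : P y - P x ≤ Ψ' (x - y) := by
    -- Minimality along the segment and convexity of `P` bound every difference quotient of `Ψ`
    -- below by `P y - P x`.
    refine ge_of_tendsto hlim ?_
    filter_upwards [Ioc_mem_nhdsGT (zero_lt_one (α := ℝ))] with t ht
    have heq : y + t • (x - y) = (1 - t) • y + t • x := by module
    have hmem : (1 - t) • y + t • x ∈ D :=
      hP.1 hy hx (by linarith [ht.2]) ht.1.le (by ring)
    have h1 := hP.2 hy hx (by linarith [ht.2] : 0 ≤ 1 - t) ht.1.le (by ring)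
    have h2 := hmin _ hmem
    simp only [smul_eq_mul] at h1
    rw [zero_add, zero_smul, add_zero, smul_eq_mul, le_inv_mul_iff₀ ht.1, heq]
    linarith
  linarith

/-- First-order lower bound for strongly convex functions. -/
theorem StrongConvexOn.add_le_of_hasFDerivAt {E : Type*} [NormedAddCommGroup E] [NormedSpace ℝ E]
    {K : Set E} {h : E → ℝ} {h' : E →L[ℝ] ℝ} {μ : ℝ} {x y : E} (hh : StrongConvexOn K μ h)
    (hd : HasFDerivAt h h' y) (hx : x ∈ K) (hy : y ∈ K) :
    h y + h' (x - y) + μ / 2 * ‖x - y‖ ^ 2 ≤ h x := by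
  have hd : HasDerivAt (fun t : ℝ => h (y + t • (x - y))) (h' (x - y)) 0 := by
    have := (show HasFDerivAt h h' (y + (0 : ℝ) • (x - y)) by simpa using hd).comp_hasDerivAt (0 : ℝ)
      (((hasDerivAt_id (0 : ℝ)).smul_const (x - y)).const_add y)
    simpa using! this
  have hlim := hd.tendsto_slope_zero_right
  have hlim2 : Filter.Tendsto (fun t : ℝ => h x - h y - (1 - t) * (μ / 2 * ‖x - y‖ ^ 2))
      (nhdsWithin 0 (Set.Ioi 0)) (nhds (h x - h y - (1 - 0) * (μ / 2 * ‖x - y‖ ^ 2))) :=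
    (Continuous.tendsto (by fun_prop) 0).mono_left nhdsWithin_le_nhds
  have := le_of_tendsto_of_tendsto hlim hlim2 (by
    filter_upwards [Ioc_mem_nhdsGT (zero_lt_one (α := ℝ))] with t ht
    have heq : y + t • (x - y) = (1 - t) • y + t • x := by module
    have h1 := hh.2 hy hx (by linarith [ht.2] : 0 ≤ 1 - t) ht.1.le (by ring)
    simp only [smul_eq_mul] at h1
    rw [norm_sub_rev y x] at h1
    rw [zero_add, zero_smul, add_zero, smul_eq_mul, inv_mul_le_iff₀ ht.1, heq]
    linarith)
  linarith

/-- After division by `t`, let `t → 0`. This removes the curvature term from optimality conditions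
along a segment. -/
theorem nonneg_of_forall_add_sq_nonneg {a b : ℝ}
    (h : ∀ t ∈ Set.Ioc (0 : ℝ) 1, 0 ≤ t * a + t ^ 2 * b) : 0 ≤ a := by
  have hlim : Filter.Tendsto (fun t : ℝ => a + t * b) (nhdsWithin 0 (Set.Ioi 0))
      (nhds (a + 0 * b)) :=
    (Continuous.tendsto (by fun_prop) 0).mono_left nhdsWithin_le_nhds
  rw [zero_mul, add_zero] at hlim
  refine ge_of_tendsto hlim ?_
  filter_upwards [Ioc_mem_nhdsGT (zero_lt_one (α := ℝ))] with t ht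
  have := h t ht
  rw [pow_two, mul_assoc, ← mul_add] at this
  exact nonneg_of_mul_nonneg_right this ht.1

/-! ### Quadratic growth on one polyhedral piece. -/

section

variable {E F : Type*} [NormedAddCommGroup E] [InnerProductSpace ℝ E]

theorem quadratic_expansion {Q : E →ₗ[ℝ] E} (hQ : Q.IsSymmetric) (a : E) (α : ℝ) (x y : E) :
    ⟪x, Q x⟫ / 2 + ⟪a, x⟫ + α =
      ⟪y, Q y⟫ / 2 + ⟪a, y⟫ + α + ⟪Q y + a, x - y⟫ + ⟪x - y, Q (x - y)⟫ / 2 := by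
  have h1 : ⟪y, Q x⟫ = ⟪x, Q y⟫ := by rw [← hQ, real_inner_comm]
  have h2 : ⟪Q y, y⟫ = ⟪y, Q y⟫ := real_inner_comm _ _
  have h3 : ⟪Q y, x⟫ = ⟪x, Q y⟫ := real_inner_comm _ _
  simp only [map_sub, inner_sub_left, inner_sub_right, inner_add_left, h1, h2, h3]
  ring

variable [FiniteDimensional ℝ E]

theorem isCompact_infDist_le {Ω : Set E} (hΩ : IsCompact Ω) (hne : Ω.Nonempty) (r : ℝ) :
    IsCompact {x | Metric.infDist x Ω ≤ r} := by
  refine Metric.isCompact_of_isClosed_isBounded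
    (isClosed_le (Metric.continuous_infDist_pt Ω) continuous_const) ?_
  refine (hΩ.isBounded.cthickening (δ := r)).subset fun x hx => ?_
  rw [Metric.mem_cthickening_iff, ENNReal.le_ofReal_iff_toReal_le
    (Metric.infEDist_ne_top hne) (Metric.infDist_nonneg.trans hx)]
  exact hx

variable [NormedAddCommGroup F] [InnerProductSpace ℝ F] [FiniteDimensional ℝ F]

/-- Quadratic growth on a single polyhedral piece. -/
theorem quadratic_growth_on_piece {k : ℕ} (a : Fin k → E) (β : Fin k → ℝ) {D Ω : Set E}
    {Φ P : E → ℝ} (A : E →L[ℝ] F) (hSD : {z | ∀ i, ⟪a i, z⟫ ≤ β i} ⊆ D) (hP : ConvexOn ℝ D P)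
    {Q : E →ₗ[ℝ] E} (hQ : Q.IsSymmetric) {b : E} {α : ℝ}
    (hPQ : ∀ x, (∀ i, ⟪a i, x⟫ ≤ β i) → P x = ⟪x, Q x⟫ / 2 + ⟪b, x⟫ + α)
    (hΦ : Differentiable ℝ Φ)
    (hstrong : ∀ r : ℝ, ∃ μ : ℝ, 0 < μ ∧ ∀ x y, ‖x‖ ≤ r → ‖y‖ ≤ r →
      Φ y + fderiv ℝ Φ y (x - y) + μ / 2 * ‖A (x - y)‖ ^ 2 ≤ Φ x)
    (hker : ∀ x y, A (x - y) = 0 → Φ x = Φ y + fderiv ℝ Φ y (x - y))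
    (hΩ : Ω = {x | x ∈ D ∧ ∀ z ∈ D, Φ x + P x ≤ Φ z + P z})
    (hΩc : IsCompact Ω) {ω : E} (hω : ω ∈ Ω) (r : ℝ) :
    ∃ κ : ℝ, 0 < κ ∧ ∀ x, (∀ i, ⟪a i, x⟫ ≤ β i) → Metric.infDist x Ω ≤ r →
      κ * Metric.infDist x Ω ^ 2 ≤ Φ x + P x - (Φ ω + P ω) := by
  set S := {z | ∀ i, ⟪a i, z⟫ ≤ β i} with hS
  have hBc : IsCompact {x | Metric.infDist x Ω ≤ r} := isCompact_infDist_le hΩc ⟨ω, hω⟩ r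
  have hωΩ := hω
  rw [hΩ] at hωΩ
  by_cases hne : (S ∩ Ω).Nonempty
  · obtain ⟨y, hyS, hyΩ⟩ := hne
    have hyΩ' := hyΩ
    rw [hΩ] at hyΩ'
    have hval : Φ ω + P ω = Φ y + P y := le_antisymm (hωΩ.2 y hyΩ'.1) (hyΩ'.2 ω hωΩ.1)
    obtain ⟨M, hM⟩ := hBc.isBounded.exists_norm_le
    obtain ⟨μ, hμ, hμΦ⟩ := hstrong (max M ‖y‖)
    -- The quadratic part of `P` on the piece plus the guaranteed curvature of `Φ`.
    set T : E →ₗ[ℝ] E := Q + μ • (A.adjoint ∘L A).toLinearMap with hT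
    have hTapp : ∀ d, ⟪d, T d⟫ = ⟪d, Q d⟫ + μ * ‖A d‖ ^ 2 := fun d => by
      simp only [hT, LinearMap.add_apply, LinearMap.smul_apply, ContinuousLinearMap.coe_coe,
        ContinuousLinearMap.comp_apply, inner_add_right, real_inner_smul_right,
        ContinuousLinearMap.adjoint_inner_right, real_inner_self_eq_norm_sq]
    have hTs : T.IsSymmetric := fun u v => by
      simp only [hT, LinearMap.add_apply, LinearMap.smul_apply, ContinuousLinearMap.coe_coe,
        ContinuousLinearMap.comp_apply, inner_add_right, inner_add_left, real_inner_smul_right,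
        real_inner_smul_left, ContinuousLinearMap.adjoint_inner_right,
        ContinuousLinearMap.adjoint_inner_left, hQ u v]
    set g : E := Q y + b + (InnerProductSpace.toDual ℝ E).symm (fderiv ℝ Φ y) with hg
    have hgapp : ∀ d, ⟪g, d⟫ = ⟪Q y + b, d⟫ + fderiv ℝ Φ y d := fun d => by
      rw [hg, inner_add_left, InnerProductSpace.toDual_symm_apply]
    have hexp : ∀ x ∈ S, P x = P y + ⟪Q y + b, x - y⟫ + ⟪x - y, Q (x - y)⟫ / 2 := fun x hx => by
      rw [hPQ x hx, hPQ y hyS]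
      exact quadratic_expansion hQ b α x y
    have hfo : ∀ x ∈ S, P y - fderiv ℝ Φ y (x - y) ≤ P x := fun x hx =>
      hP.sub_le_of_isMinOn_add (hΦ y).hasFDerivAt hyΩ'.1 hyΩ'.2 (hSD hx)
    have hg0 : ∀ x ∈ S, 0 ≤ ⟪g, x - y⟫ := fun x hx => by
      refine nonneg_of_forall_add_sq_nonneg (b := ⟪x - y, Q (x - y)⟫ / 2) fun t ht => ?_
      have heq : (1 - t) • y + t • x - y = t • (x - y) := by module
      have hmem : (1 - t) • y + t • x ∈ S :=
        convex_polyhedron a β hyS hx (by linarith [ht.2]) ht.1.le (by ring)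
      have h1 := hfo _ hmem
      have h2 := hexp _ hmem
      simp only [heq, map_smul, real_inner_smul_left, real_inner_smul_right, smul_eq_mul] at h1 h2
      rw [hgapp]
      linarith
    -- Midpoint convexity of `P` makes `Q` nonnegative on differences of points of the piece; `Q`
    -- need not be semidefinite on `E`.
    have hQ0 : ∀ x ∈ S, ∀ z ∈ S, 0 ≤ ⟪x - z, Q (x - z)⟫ := fun x hx z hz => by
      have hmem : (1 / 2 : ℝ) • x + (1 / 2 : ℝ) • z ∈ S :=
        convex_polyhedron a β hx hz (by norm_num) (by norm_num) (by norm_num)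
      have h1 := hP.2 (hSD hx) (hSD hz) (by norm_num : (0 : ℝ) ≤ 1 / 2)
        (by norm_num : (0 : ℝ) ≤ 1 / 2) (by norm_num)
      rw [hPQ _ hmem, hPQ x hx, hPQ z hz] at h1
      have h2 : ⟪z, Q x⟫ = ⟪x, Q z⟫ := by rw [← hQ, real_inner_comm]
      simp only [map_add, map_smul, real_inner_smul_left, real_inner_smul_right, smul_eq_mul,
        inner_add_left, inner_add_right, h2] at h1
      simp only [map_sub, inner_sub_left, inner_sub_right, h2]
      linarith
    obtain ⟨κ, hκ, hgrowth⟩ := quadratic_growth_on_polyhedron a β T hTs g hyS hg0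
      (fun x hx z hz => by
        rw [hTapp]
        have := hQ0 x hx z hz
        positivity) (M + ‖y‖)
    refine ⟨κ, hκ, fun x hx hxr => ?_⟩
    have hxM : ‖x‖ ≤ M := hM x hxr
    have h1 := hgrowth x hx ((norm_sub_le x y).trans (by linarith))
    have h2 := hμΦ x y (hxM.trans (le_max_left _ _)) (le_max_right _ _)
    have h3 := hexp x hx
    rw [hTapp, hgapp] at h1
    -- Vanishing of the form forces both nonnegative summands to vanish, so `A (z - y) = 0` and the
    -- lower model is exact at `z`.
    have hZ : {z | (∀ i, ⟪a i, z⟫ ≤ β i) ∧ ⟪g, z - y⟫ = 0 ∧ ⟪z - y, T (z - y)⟫ = 0} ⊆ Ω := by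
      rintro z ⟨hzS, hz1, hz2⟩
      rw [hTapp] at hz2
      have h4 := hQ0 z hzS y hyS
      have h5 : 0 ≤ μ * ‖A (z - y)‖ ^ 2 := by positivity
      have h6 : ‖A (z - y)‖ ^ 2 = 0 := by
        have : μ * ‖A (z - y)‖ ^ 2 = 0 := by linarith
        exact (mul_eq_zero.1 this).resolve_left hμ.ne'
      have h7 := hker z y (by simpa using h6)
      have h8 := hexp z hzS
      rw [hgapp] at hz1
      rw [hΩ]
      refine ⟨hSD hzS, fun w hw => ?_⟩
      have := hyΩ'.2 w hw
      linarith
    have h9 : Metric.infDist x Ω ≤ _ :=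
      Metric.infDist_le_infDist_of_subset hZ ⟨y, hyS, by simp, by simp⟩
    have h10 := mul_le_mul_of_nonneg_left (pow_le_pow_left₀ Metric.infDist_nonneg h9 2) hκ.le
    linarith
  · have hSB : IsCompact (S ∩ {x | Metric.infDist x Ω ≤ r}) :=
      hBc.inter_left (isClosed_polyhedron a β)
    rcases (S ∩ {x | Metric.infDist x Ω ≤ r}).eq_empty_or_nonempty with hemp | hnem
    · exact ⟨1, one_pos, fun x hx hxr => absurd (show x ∈ S ∩ {x | Metric.infDist x Ω ≤ r} from
        ⟨hx, hxr⟩) (by simp [hemp])⟩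
    have hcont : ContinuousOn (fun x => Φ x + P x) (S ∩ {x | Metric.infDist x Ω ≤ r}) := by
      have hQc : Continuous Q := Q.continuous_of_finiteDimensional
      have : ContinuousOn (fun x => Φ x + (⟪x, Q x⟫ / 2 + ⟪b, x⟫ + α))
          (S ∩ {x | Metric.infDist x Ω ≤ r}) :=
        (hΦ.continuous.add (by fun_prop)).continuousOn
      exact this.congr fun x hx => by rw [hPQ x hx.1]
    obtain ⟨x₀, hx₀, hmin⟩ := hSB.exists_isMinOn hnem hcont
    -- The piece misses `Ω`, so the objective's minimum over its compact part exceeds the optimal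
    -- value.
    have hδ : 0 < Φ x₀ + P x₀ - (Φ ω + P ω) := by
      by_contra! hle
      refine hne ⟨x₀, hx₀.1, ?_⟩
      rw [hΩ]
      exact ⟨hSD hx₀.1, fun w hw => by linarith [hωΩ.2 w hw]⟩
    refine ⟨(Φ x₀ + P x₀ - (Φ ω + P ω)) / (r ^ 2 + 1), by positivity, fun x hx hxr => ?_⟩
    have h1 : Φ x₀ + P x₀ ≤ Φ x + P x := hmin ⟨hx, hxr⟩
    have h2 : Metric.infDist x Ω ^ 2 ≤ r ^ 2 := pow_le_pow_left₀ Metric.infDist_nonneg hxr 2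
    calc _ ≤ (Φ x₀ + P x₀ - (Φ ω + P ω)) / (r ^ 2 + 1) * (r ^ 2 + 1) :=
          mul_le_mul_of_nonneg_left (by linarith) (by positivity)
      _ = Φ x₀ + P x₀ - (Φ ω + P ω) := by field_simp
      _ ≤ _ := by linarith

end

theorem exists_pos_forall_le {ι : Type*} [Finite ι] {κ : ι → ℝ} (hκ : ∀ i, 0 < κ i) :
    ∃ κ₀ : ℝ, 0 < κ₀ ∧ ∀ i, κ₀ ≤ κ i := by
  have : ∀ᶠ t in nhdsWithin (0 : ℝ) (Set.Ioi 0), ∀ i, t ≤ κ i :=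
    Filter.eventually_all.2 fun i => by
      filter_upwards [Ioc_mem_nhdsGT (hκ i)] with t ht using ht.2
  obtain ⟨t, ht, ht0⟩ := (this.and self_mem_nhdsWithin).exists
  exact ⟨t, ht0, ht⟩

/-! ### From quadratic growth to distance bounds. -/

section

variable {E F : Type*} [NormedAddCommGroup E] [InnerProductSpace ℝ E]

/-- Under quadratic growth at `y`, subgradients at `y` bound the distance to the minimizers. -/
theorem infDist_le_mul_norm_of_quadratic_growth {Ω : Set E} (hΩc : IsCompact Ω)
    (hne : Ω.Nonempty) {φ : E → ℝ} {κ : ℝ} (hκ : 0 < κ) {y v : E}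
    (hgrowth : ∀ ω ∈ Ω, κ * Metric.infDist y Ω ^ 2 ≤ φ y - φ ω)
    (hv : ∀ ω ∈ Ω, φ y + ⟪v, ω - y⟫ ≤ φ ω) : Metric.infDist y Ω ≤ κ⁻¹ * ‖v‖ := by
  obtain ⟨ω, hω, hd⟩ := hΩc.exists_infDist_eq_dist hne y
  have h1 := hgrowth ω hω
  have h2 := hv ω hω
  have h3 : -⟪v, ω - y⟫ ≤ ‖v‖ * ‖ω - y‖ := (neg_le_abs _).trans (abs_real_inner_le_norm _ _)
  rw [← dist_eq_norm, dist_comm, ← hd] at h3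
  rcases (Metric.infDist_nonneg (x := y) (s := Ω)).eq_or_lt with h | h
  · rw [← h]
    positivity
  · rw [le_inv_mul_iff₀ hκ]
    refine le_of_mul_le_mul_right ?_ h
    calc _ = κ * Metric.infDist y Ω ^ 2 := by ring
      _ ≤ _ := by linarith

/-- Quadratic growth on a neighbourhood bounds the sublevel sets of a convex function. -/
theorem infDist_le_of_sublevel {D Ω : Set E} (hΩc : IsCompact Ω) (hΩD : Ω ⊆ D) {φ : E → ℝ}
    (hφ : ConvexOn ℝ D φ) {κ : ℝ} (hκ : 0 < κ)
    (hgrowth : ∀ ω ∈ Ω, ∀ x ∈ D, Metric.infDist x Ω ≤ 1 →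
      κ * Metric.infDist x Ω ^ 2 ≤ φ x - φ ω)
    {ω₀ : E} (hω₀ : ω₀ ∈ Ω) (hval : ∀ ω ∈ Ω, φ ω = φ ω₀)
    {x : E} (hx : x ∈ D) {ξ : ℝ} (hξ : φ x ≤ ξ) :
    Metric.infDist x Ω ≤ max 1 ((ξ - φ ω₀) / κ) := by
  rcases le_or_gt (Metric.infDist x Ω) 1 with h | h
  · exact h.trans (le_max_left _ _)
  refine le_max_of_le_right ?_
  obtain ⟨ω, hω, hd⟩ := hΩc.exists_infDist_eq_dist ⟨ω₀, hω₀⟩ x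
  set d := Metric.infDist x Ω
  have hd0 : 0 < d := one_pos.trans h
  have hdn : ‖x - ω‖ = d := by rw [hd, dist_eq_norm]
  have ht1 : d⁻¹ ≤ 1 := inv_le_one_of_one_le₀ h.le
  -- `z` lies at distance `1` from the nearest minimizer `ω` on the segment to `x`, hence at
  -- distance exactly `1` from `Ω`. Growth at `z` and convexity give `κ ≤ d⁻¹ (φ x - φ ω)`.
  set z := (1 - d⁻¹) • ω + d⁻¹ • x with hz
  have hzD : z ∈ D := hφ.1 (hΩD hω) hx (by linarith) (by positivity) (by ring)
  have hzω : dist z ω = 1 := by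
    rw [dist_eq_norm, show z - ω = d⁻¹ • (x - ω) by rw [hz]; module, norm_smul, hdn,
      Real.norm_of_nonneg (by positivity), inv_mul_cancel₀ hd0.ne']
  have hzx : dist x z = d - 1 := by
    rw [dist_eq_norm, show x - z = (1 - d⁻¹) • (x - ω) by rw [hz]; module, norm_smul, hdn,
      Real.norm_of_nonneg (by linarith), sub_mul, inv_mul_cancel₀ hd0.ne', one_mul]
  have hz1 : Metric.infDist z Ω ≤ 1 := hzω ▸ Metric.infDist_le_dist_of_mem hω
  have hz2 : 1 ≤ Metric.infDist z Ω := by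
    have : d ≤ Metric.infDist z Ω + dist x z := Metric.infDist_le_infDist_add_dist
    linarith
  have h1 := hgrowth ω hω z hzD hz1
  rw [le_antisymm hz1 hz2] at h1
  have h2 := hφ.2 (hΩD hω) hx (by linarith : 0 ≤ 1 - d⁻¹) (by positivity : 0 ≤ d⁻¹) (by ring)
  rw [← hz] at h2
  simp only [smul_eq_mul] at h2
  have h3 : κ ≤ d⁻¹ * (ξ - φ ω₀) := by
    have := mul_le_mul_of_nonneg_left hξ (inv_nonneg.2 hd0.le)
    rw [hval ω hω] at h1 h2
    linarith
  rw [le_inv_mul_iff₀ hd0] at h3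
  rwa [le_div_iff₀ hκ]

variable [FiniteDimensional ℝ E]
  [NormedAddCommGroup F] [InnerProductSpace ℝ F] [FiniteDimensional ℝ F]

/-- Quadratic growth around the set of minimizers of a piecewise quadratic convex composite
problem. -/
theorem quadratic_growth {N : ℕ} {S : Fin N → Set E} (hS : ∀ i, IsPolyhedral (S i)) {D Ω : Set E}
    (hD : D = ⋃ i, S i) {Φ P : E → ℝ} (A : E →L[ℝ] F) (hP : ConvexOn ℝ D P)
    (hPQ : ∀ i, ∃ (Q : E →ₗ[ℝ] E) (b : E) (α : ℝ), Q.IsSymmetric ∧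
      ∀ x ∈ S i, P x = ⟪x, Q x⟫ / 2 + ⟪b, x⟫ + α)
    (hΦ : Differentiable ℝ Φ)
    (hstrong : ∀ r : ℝ, ∃ μ : ℝ, 0 < μ ∧ ∀ x y, ‖x‖ ≤ r → ‖y‖ ≤ r →
      Φ y + fderiv ℝ Φ y (x - y) + μ / 2 * ‖A (x - y)‖ ^ 2 ≤ Φ x)
    (hker : ∀ x y, A (x - y) = 0 → Φ x = Φ y + fderiv ℝ Φ y (x - y))
    (hΩ : Ω = {x | x ∈ D ∧ ∀ z ∈ D, Φ x + P x ≤ Φ z + P z})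
    (hΩc : IsCompact Ω) (hne : Ω.Nonempty) (r : ℝ) :
    ∃ κ : ℝ, 0 < κ ∧ ∀ ω ∈ Ω, ∀ x ∈ D, Metric.infDist x Ω ≤ r →
      κ * Metric.infDist x Ω ^ 2 ≤ Φ x + P x - (Φ ω + P ω) := by
  obtain ⟨ω₀, hω₀⟩ := hne
  have hpiece : ∀ i, ∃ κ : ℝ, 0 < κ ∧ ∀ x ∈ S i, Metric.infDist x Ω ≤ r →
      κ * Metric.infDist x Ω ^ 2 ≤ Φ x + P x - (Φ ω₀ + P ω₀) := by
    intro i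
    obtain ⟨k, a, β, hSi⟩ := hS i
    obtain ⟨Q, b, α, hQ, hPi⟩ := hPQ i
    have hmem : ∀ x, x ∈ S i ↔ ∀ j, ⟪a j, x⟫ ≤ β j := fun x => by rw [hSi]; rfl
    simp only [hmem] at hPi ⊢
    refine quadratic_growth_on_piece a β A ?_ hP hQ hPi hΦ hstrong hker hΩ hΩc hω₀ r
    rw [← hSi, hD]
    exact Set.subset_iUnion S i
  choose κ hκ hgrowth using hpiece
  obtain ⟨κ₀, hκ₀, hle⟩ := exists_pos_forall_le hκ
  refine ⟨κ₀, hκ₀, fun ω hω x hx hxr => ?_⟩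
  have h0 := hω₀
  rw [hΩ] at h0 hω
  have hval : Φ ω + P ω = Φ ω₀ + P ω₀ := le_antisymm (hω.2 _ h0.1) (h0.2 _ hω.1)
  rw [hD] at hx
  obtain ⟨i, hi⟩ := Set.mem_iUnion.1 hx
  rw [hval]
  exact (mul_le_mul_of_nonneg_right (hle i) (sq_nonneg _)).trans (hgrowth i x hi hxr)

/-- A `C¹` gradient is locally Lipschitz, hence Lipschitz on compact balls; a bounded region is all
the residual bound requires. -/
theorem exists_lipschitzOnWith_gradient {Φ : E → ℝ} (hΦ : ContDiff ℝ 2 Φ) (M : ℝ) :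
    ∃ K, LipschitzOnWith K (gradient Φ) (Metric.closedBall 0 M) := by
  have h1 : ContDiff ℝ 1 (gradient Φ) :=
    (InnerProductSpace.toDual ℝ E).symm.contDiff.comp (hΦ.fderiv_right (m := 1) (by norm_num))
  exact (h1.locallyLipschitz.locallyLipschitzOn).exists_lipschitzOnWith_of_compact
    (isCompact_closedBall 0 M)

end

/-! ### Reduction from extended-real to real values; existence of proximal points. -/

section

variable {E : Type*} [NormedAddCommGroup E] [InnerProductSpace ℝ E]

theorem IsClosedProperConvex.coe_toReal {q : E → EReal} (hq : IsClosedProperConvex q) {x : E}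
    (hx : q x < ⊤) : q x = ((q x).toReal : EReal) :=
  (EReal.coe_toReal hx.ne (hq.ne_bot x)).symm

/-- The restriction to the effective domain matters: outside it `toReal` takes the default value
`0`. -/
theorem IsClosedProperConvex.convexOn_toReal {q : E → EReal} (hq : IsClosedProperConvex q) :
    ConvexOn ℝ {x | q x < ⊤} (fun x => (q x).toReal) := by
  have key : ∀ x, q x < ⊤ → ∀ y, q y < ⊤ → ∀ s t : ℝ, 0 ≤ s → 0 ≤ t → s + t = 1 →
      q (s • x + t • y) ≤ ((s * (q x).toReal + t * (q y).toReal : ℝ) : EReal) := by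
    intro x hx y hy s t hs ht hst
    exact hq.convex (x := (x, (q x).toReal)) (hq.coe_toReal hx).le (y := (y, (q y).toReal))
      (hq.coe_toReal hy).le hs ht hst
  refine ⟨fun x hx y hy s t hs ht hst => (key x hx y hy s t hs ht hst).trans_lt
    (EReal.coe_lt_top _), fun x hx y hy s t hs ht hst => ?_⟩
  have h := key x hx y hy s t hs ht hst
  rw [hq.coe_toReal (h.trans_lt (EReal.coe_lt_top _)), EReal.coe_le_coe_iff] at h
  exact h

theorem IsClosedProperConvex.coe_mul_of_lt_top {q : E → EReal} (hq : IsClosedProperConvex q)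
    (lam : ℝ) {x : E} (hx : q x < ⊤) :
    (lam : EReal) * q x = ((lam * (q x).toReal : ℝ) : EReal) := by
  rw [EReal.coe_mul, ← hq.coe_toReal hx]

theorem coe_mul_eq_top_of_not_lt {lam : ℝ} (hlam : 0 < lam) {e : EReal} (he : ¬ e < ⊤) :
    (lam : EReal) * e = ⊤ := by
  rw [not_lt_top_iff.1 he, EReal.coe_mul_top_of_pos hlam]

/-- The minimizers of a finite function plus a positive multiple of a proper function. -/
theorem IsClosedProperConvex.minimizers_coe_add_mul {q : E → EReal}
    (hq : IsClosedProperConvex q) {lam : ℝ} (hlam : 0 < lam) (Ψ : E → ℝ) :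
    minimizers (fun x => (Ψ x : EReal) + (lam : EReal) * q x) =
      {x | x ∈ {x | q x < ⊤} ∧ ∀ z ∈ {x | q x < ⊤},
        Ψ x + lam * (q x).toReal ≤ Ψ z + lam * (q z).toReal} := by
  have hval : ∀ x, q x < ⊤ → (Ψ x : EReal) + (lam : EReal) * q x =
      ((Ψ x + lam * (q x).toReal : ℝ) : EReal) := fun x hx => by
    rw [hq.coe_mul_of_lt_top lam hx, ← EReal.coe_add]
  have htop : ∀ x, ¬ q x < ⊤ → (Ψ x : EReal) + (lam : EReal) * q x = ⊤ := fun x hx => by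
    rw [coe_mul_eq_top_of_not_lt hlam hx, EReal.coe_add_top]
  ext x
  constructor
  · intro hx
    have hxD : q x < ⊤ := by
      by_contra hcon
      obtain ⟨z, hz⟩ := hq.exists_ne_top
      have : _ ≤ _ := hx z
      dsimp only at this
      rw [htop x hcon, hval z (lt_top_iff_ne_top.2 hz), top_le_iff] at this
      exact EReal.coe_ne_top _ this
    refine ⟨hxD, fun z hz => ?_⟩
    have : _ ≤ _ := hx z
    dsimp only at this
    rwa [hval x hxD, hval z hz, EReal.coe_le_coe_iff] at this
  · rintro ⟨hxD, hx⟩ z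
    by_cases hz : q z < ⊤
    · dsimp only
      rw [hval x hxD, hval z hz, EReal.coe_le_coe_iff]
      exact hx z hz
    · dsimp only
      rw [htop z hz]
      exact le_top

theorem IsClosedProperConvex.lowerSemicontinuous_mul_add {q : E → EReal}
    (hq : IsClosedProperConvex q) {lam : ℝ} (hlam : 0 < lam) {Ψ : E → ℝ} (hΨ : Continuous Ψ) :
    LowerSemicontinuous (fun x => (Ψ x : EReal) + (lam : EReal) * q x) := by
  have hmul : Continuous fun e : EReal => (lam : EReal) * e := by
    rw [continuous_iff_continuousAt]
    intro e
    have h0 : (lam : EReal) ≠ 0 := by exact_mod_cast hlam.ne'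
    exact (EReal.continuousAt_mul (p := ((lam : EReal), e)) (Or.inl h0) (Or.inl h0)
      (Or.inl (EReal.coe_ne_bot _)) (Or.inl (EReal.coe_ne_top _))).comp
      (f := fun e : EReal => ((lam : EReal), e)) (by fun_prop)
  have hmono : Monotone fun e : EReal => (lam : EReal) * e := fun a b hab =>
    mul_le_mul_of_nonneg_left hab (by exact_mod_cast hlam.le)
  refine (continuous_coe_real_ereal.comp hΨ).lowerSemicontinuous.add'
    (hmul.comp_lowerSemicontinuous hq.closed hmono) fun x => ?_
  exact EReal.continuousAt_add (Or.inl (EReal.coe_ne_top _)) (Or.inl (EReal.coe_ne_bot _))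

/-- The proximal mapping of a closed convex function with an affine minorant attains its minimum. -/
theorem IsClosedProperConvex.prox_mem_minimizers [FiniteDimensional ℝ E] {q : E → EReal}
    (hq : IsClosedProperConvex q) {lam : ℝ} (hlam : 0 < lam) {v : E} {α : ℝ}
    (hminor : ∀ x, q x < ⊤ → α + ⟪v, x⟫ ≤ lam * (q x).toReal) (w : E) :
    prox (fun u => (lam : EReal) * q u) w ∈
      {x | x ∈ {x | q x < ⊤} ∧ ∀ z ∈ {x | q x < ⊤},
        ‖x - w‖ ^ 2 / 2 + lam * (q x).toReal ≤ ‖z - w‖ ^ 2 / 2 + lam * (q z).toReal} := by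
  have hcomm : (fun u => (lam : EReal) * q u + ((‖u - w‖ ^ 2 / 2 : ℝ) : EReal)) =
      fun u => ((‖u - w‖ ^ 2 / 2 : ℝ) : EReal) + (lam : EReal) * q u :=
    funext fun u => add_comm _ _
  unfold prox
  rw [← hq.minimizers_coe_add_mul hlam (fun u => ‖u - w‖ ^ 2 / 2), hcomm]
  refine Classical.epsilon_spec ?_
  rw [hq.minimizers_coe_add_mul hlam (fun u => ‖u - w‖ ^ 2 / 2)]
  obtain ⟨x₀, hx₀⟩ := hq.exists_ne_top
  have hx₀ : q x₀ < ⊤ := lt_top_iff_ne_top.2 hx₀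
  set c₀ := ‖x₀ - w‖ ^ 2 / 2 + lam * (q x₀).toReal with hc₀
  set C := |c₀ - α - ⟪v, w⟫| with hC
  -- Beyond radius `B` half the squared distance outgrows the affine minorant's loss `‖v‖‖u - w‖ +
  -- C`, so no competitor there beats `x₀`, and the minimization reduces to a compact ball.
  set B := 2 * ‖v‖ + 2 * C + 1 with hB
  have hcoer : ∀ u, q u < ⊤ → ‖u - w‖ ^ 2 / 2 + lam * (q u).toReal ≤ c₀ →
      u ∈ Metric.closedBall w B := by
    intro u hu hle
    rw [mem_closedBall_iff_norm]
    by_contra! hlt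
    have h1 := hminor u hu
    have h2 : -⟪v, u - w⟫ ≤ ‖v‖ * ‖u - w‖ := (neg_le_abs _).trans (abs_real_inner_le_norm _ _)
    have h3 : c₀ - α - ⟪v, w⟫ ≤ C := le_abs_self _
    rw [inner_sub_right] at h2
    have hC0 : 0 ≤ C := abs_nonneg _
    have h4 : ‖u - w‖ * (‖v‖ + C + 1 / 2) ≤ ‖u - w‖ ^ 2 / 2 := by nlinarith [norm_nonneg (u - w)]
    have h5 : 1 ≤ ‖u - w‖ := by linarith [norm_nonneg v]
    have h6 : C ≤ ‖u - w‖ * C := le_mul_of_one_le_left hC0 h5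
    nlinarith
  have hne : (Metric.closedBall w B).Nonempty := ⟨x₀, hcoer x₀ hx₀ le_rfl⟩
  obtain ⟨y, hyB, hy⟩ := LowerSemicontinuousOn.exists_isMinOn hne (isCompact_closedBall w B)
    ((hq.lowerSemicontinuous_mul_add hlam (Ψ := fun u => ‖u - w‖ ^ 2 / 2)
      (by fun_prop)).lowerSemicontinuousOn _)
  have hval : ∀ x, q x < ⊤ → ((‖x - w‖ ^ 2 / 2 : ℝ) : EReal) + (lam : EReal) * q x =
      ((‖x - w‖ ^ 2 / 2 + lam * (q x).toReal : ℝ) : EReal) := fun x hx => by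
    rw [hq.coe_mul_of_lt_top lam hx, ← EReal.coe_add]
  have hyx₀ := isMinOn_iff.1 hy _ (hcoer x₀ hx₀ le_rfl)
  rw [hval x₀ hx₀] at hyx₀
  have hyD : q y < ⊤ := by
    by_contra hcon
    rw [coe_mul_eq_top_of_not_lt hlam hcon, EReal.coe_add_top, top_le_iff] at hyx₀
    exact EReal.coe_ne_top _ hyx₀
  rw [hval y hyD, EReal.coe_le_coe_iff] at hyx₀
  refine ⟨y, hyD, fun z hz => ?_⟩
  rcases le_or_gt (‖z - w‖ ^ 2 / 2 + lam * (q z).toReal) c₀ with h | h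
  · have := isMinOn_iff.1 hy _ (hcoer z hz h)
    rwa [hval y hyD, hval z hz, EReal.coe_le_coe_iff] at this
  · exact hyx₀.trans h.le

end

/-! ### The composite objective and its two error bounds. -/

section

variable {m n : ℕ} {A : Matrix (Fin m) (Fin n) ℝ} {c : EuclideanSpace ℝ (Fin n)}
  {h : EuclideanSpace ℝ (Fin m) → ℝ} {p : EuclideanSpace ℝ (Fin n) → EReal} {lam : ℝ}

theorem contDiff_smoothPart (hh : ContDiff ℝ 2 h) : ContDiff ℝ 2 (smoothPart A c h) :=
  (hh.comp (A.toEuclideanLin.toContinuousLinearMap.contDiff)).sub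
    ((innerSL ℝ c).contDiff)

theorem fderiv_smoothPart_apply (hh : Differentiable ℝ h) (y d : EuclideanSpace ℝ (Fin n)) :
    fderiv ℝ (smoothPart A c h) y d =
      fderiv ℝ h (A.toEuclideanLin y) (A.toEuclideanLin d) - ⟪c, d⟫ := by
  have h1 : HasFDerivAt (smoothPart A c h)
      ((fderiv ℝ h (A.toEuclideanLin y)).comp A.toEuclideanLin.toContinuousLinearMap -
        innerSL ℝ c) y :=
    ((hh (A.toEuclideanLin y)).hasFDerivAt.comp y
      A.toEuclideanLin.toContinuousLinearMap.hasFDerivAt).sub (innerSL ℝ c).hasFDerivAt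
  rw [h1.fderiv]
  rfl

/-- `A` maps the ball of radius `r` into one of radius `‖A‖ r`, where `h` has a positive modulus;
the linear term adds no curvature. -/
theorem smoothPart_add_le (hh : Differentiable ℝ h) (hs : StronglyConvexOnCompacts h) (r : ℝ) :
    ∃ μ : ℝ, 0 < μ ∧ ∀ x y, ‖x‖ ≤ r → ‖y‖ ≤ r →
      smoothPart A c h y + fderiv ℝ (smoothPart A c h) y (x - y) +
        μ / 2 * ‖A.toEuclideanLin.toContinuousLinearMap (x - y)‖ ^ 2 ≤ smoothPart A c h x := by
  set B := A.toEuclideanLin.toContinuousLinearMap with hB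
  obtain ⟨μ, hμ, hK⟩ := hs (Metric.closedBall 0 (‖B‖ * r)) (isCompact_closedBall _ _)
    (convex_closedBall _ _)
  refine ⟨μ, hμ, fun x y hx hy => ?_⟩
  have hmem : ∀ x, ‖x‖ ≤ r → B x ∈ Metric.closedBall 0 (‖B‖ * r) := fun x hx => by
    rw [mem_closedBall_zero_iff]
    exact B.le_opNorm_of_le hx
  have h1 := hK.add_le_of_hasFDerivAt (hh (B y)).hasFDerivAt (hmem x hx) (hmem y hy)
  rw [fderiv_smoothPart_apply hh, inner_sub_right]
  rw [← map_sub] at h1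
  simp only [smoothPart]
  have h2 : ∀ z, A.toEuclideanLin z = B z := fun z => rfl
  simp only [h2]
  linarith

/-- On a fibre of `A` the term `h (A x)` is constant and only the linear term varies. -/
theorem smoothPart_eq_of_map_sub_eq_zero (hh : Differentiable ℝ h)
    (x y : EuclideanSpace ℝ (Fin n))
    (hxy : A.toEuclideanLin.toContinuousLinearMap (x - y) = 0) :
    smoothPart A c h x = smoothPart A c h y + fderiv ℝ (smoothPart A c h) y (x - y) := by
  have h1 : A.toEuclideanLin (x - y) = 0 := hxy
  rw [fderiv_smoothPart_apply hh, h1, map_zero, inner_sub_right]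
  rw [map_sub, sub_eq_zero] at h1
  simp only [smoothPart, h1]
  ring

theorem convexOn_smoothPart (hh : ConvexOn ℝ Set.univ h) :
    ConvexOn ℝ Set.univ (smoothPart A c h) := by
  refine ⟨convex_univ, fun x _ y _ s t hs ht hst => ?_⟩
  have := hh.2 (Set.mem_univ (A.toEuclideanLin x)) (Set.mem_univ (A.toEuclideanLin y)) hs ht hst
  simp only [smoothPart, map_add, map_smul, inner_add_right, real_inner_smul_right,
    smul_eq_mul] at this ⊢
  linarith

theorem IsPiecewiseLinearQuadratic.exists_pieces (hpl : IsPiecewiseLinearQuadratic p) (lam : ℝ) :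
    ∃ (N : ℕ) (S : Fin N → Set (EuclideanSpace ℝ (Fin n))), (∀ i, IsPolyhedral (S i)) ∧
      {x | p x < ⊤} = ⋃ i, S i ∧
      ∀ i, ∃ (Q : EuclideanSpace ℝ (Fin n) →ₗ[ℝ] EuclideanSpace ℝ (Fin n))
        (b : EuclideanSpace ℝ (Fin n)) (α : ℝ), Q.IsSymmetric ∧
        ∀ x ∈ S i, lam * (p x).toReal = ⟪x, Q x⟫ / 2 + ⟪b, x⟫ + α := by
  obtain ⟨N, S, hS, hD, hq⟩ := hpl
  refine ⟨N, S, hS, hD, fun i => ?_⟩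
  obtain ⟨Q, a, α, hQ, hx⟩ := hq i
  refine ⟨lam • Q.toEuclideanLin, lam • a, lam * α, ?_, fun x hxS => ?_⟩
  · exact (Matrix.isSymmetric_toEuclideanLin_iff.2 (Matrix.isHermitian_iff_isSymm.2 hQ)).smul
      (by simp)
  · rw [hx x hxS, EReal.toReal_coe, LinearMap.smul_apply, real_inner_smul_left,
      real_inner_smul_right]
    ring

/-- Quadratic growth of the objective around its set of minimizers. -/
theorem objective_quadratic_growth (hlam : 0 < lam) (hhd : ContDiff ℝ 2 h)
    (hp : IsClosedProperConvex p)
    (hne : (minimizers (objective A c h p lam)).Nonempty)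
    (hcpt : IsCompact (minimizers (objective A c h p lam)))
    (hs : StronglyConvexOnCompacts h) (hpl : IsPiecewiseLinearQuadratic p) (r : ℝ) :
    ∃ κ : ℝ, 0 < κ ∧ ∀ ω ∈ minimizers (objective A c h p lam), ∀ x ∈ {x | p x < ⊤},
      Metric.infDist x (minimizers (objective A c h p lam)) ≤ r →
      κ * Metric.infDist x (minimizers (objective A c h p lam)) ^ 2 ≤
        smoothPart A c h x + lam * (p x).toReal -
          (smoothPart A c h ω + lam * (p ω).toReal) := by
  have hdiff : Differentiable ℝ h := hhd.differentiable (by norm_num)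
  obtain ⟨N, S, hS, hD, hPQ⟩ := hpl.exists_pieces lam
  exact quadratic_growth hS hD A.toEuclideanLin.toContinuousLinearMap
    (P := fun x => lam * (p x).toReal) (hp.convexOn_toReal.smul hlam.le) hPQ
    ((contDiff_smoothPart hhd).differentiable (by norm_num)) (smoothPart_add_le hdiff hs)
    (smoothPart_eq_of_map_sub_eq_zero hdiff) (hp.minimizers_coe_add_mul hlam _) hcpt hne r

theorem objective_eq_coe (hp : IsClosedProperConvex p) (A : Matrix (Fin m) (Fin n) ℝ)
    (c : EuclideanSpace ℝ (Fin n)) (h : EuclideanSpace ℝ (Fin m) → ℝ) (lam : ℝ)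
    {x : EuclideanSpace ℝ (Fin n)} (hx : p x < ⊤) :
    objective A c h p lam x = ((smoothPart A c h x + lam * (p x).toReal : ℝ) : EReal) := by
  rw [objective, hp.coe_mul_of_lt_top lam hx, ← EReal.coe_add]

theorem objective_eq_top (hlam : 0 < lam) (A : Matrix (Fin m) (Fin n) ℝ)
    (c : EuclideanSpace ℝ (Fin n)) (h : EuclideanSpace ℝ (Fin m) → ℝ)
    {x : EuclideanSpace ℝ (Fin n)} (hx : ¬ p x < ⊤) : objective A c h p lam x = ⊤ := by
  rw [objective, coe_mul_eq_top_of_not_lt hlam hx, EReal.coe_add_top]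

theorem mem_minimizers_objective_iff (hlam : 0 < lam) (hp : IsClosedProperConvex p)
    {x : EuclideanSpace ℝ (Fin n)} :
    x ∈ minimizers (objective A c h p lam) ↔ x ∈ {x | p x < ⊤} ∧
      ∀ z ∈ {x | p x < ⊤}, smoothPart A c h x + lam * (p x).toReal ≤
        smoothPart A c h z + lam * (p z).toReal :=
  Set.ext_iff.1 (hp.minimizers_coe_add_mul hlam (smoothPart A c h)) x

/-- The subdifferential error bound. -/
theorem errorBoundCondition_objective (hlam : 0 < lam) (hhd : ContDiff ℝ 2 h)
    (hp : IsClosedProperConvex p)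
    (hne : (minimizers (objective A c h p lam)).Nonempty)
    (hcpt : IsCompact (minimizers (objective A c h p lam)))
    (hs : StronglyConvexOnCompacts h) (hpl : IsPiecewiseLinearQuadratic p) :
    ErrorBoundCondition (objective A c h p lam) := by
  intro r hr
  obtain ⟨κ, hκ, hgrowth⟩ := objective_quadratic_growth hlam hhd hp hne hcpt hs hpl r
  refine ⟨κ⁻¹, inv_pos.2 hκ, fun x hx => ?_⟩
  set Ω := minimizers (objective A c h p lam) with hΩ
  have hΩD : ∀ ω ∈ Ω, p ω < ⊤ := fun ω hω =>
    ((mem_minimizers_objective_iff hlam hp).1 hω).1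
  have hinf : ENNReal.ofReal (Metric.infDist x Ω) = Metric.infEDist x Ω :=
    ENNReal.ofReal_toReal (Metric.infEDist_ne_top hne)
  have hxr : Metric.infDist x Ω ≤ r := by
    rwa [← hinf, ENNReal.ofReal_le_ofReal_iff hr.le] at hx
  have hκ0 : ENNReal.ofReal κ⁻¹ ≠ 0 := by simpa using hκ
  -- Moving the constant across turns the claim into a lower bound for an infimum, to be checked at
  -- each subgradient; an empty subdifferential is covered.
  rw [mul_comm, ← ENNReal.div_le_iff_le_mul (Or.inl hκ0) (Or.inl ENNReal.ofReal_ne_top),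
    Metric.le_infEDist]
  intro v hv
  rw [ENNReal.div_le_iff_le_mul (Or.inl hκ0) (Or.inl ENNReal.ofReal_ne_top), mul_comm, edist_dist,
    dist_zero_left, ← ENNReal.ofReal_mul (inv_nonneg.2 hκ.le), ← hinf]
  refine ENNReal.ofReal_le_ofReal ?_
  have hxD : p x < ⊤ := by
    by_contra hcon
    obtain ⟨ω, hω⟩ := hne
    have h1 := hv ω
    rw [objective_eq_top hlam A c h hcon, objective_eq_coe hp A c h lam (hΩD ω hω),
      EReal.top_add_coe, top_le_iff] at h1
    exact EReal.coe_ne_top _ h1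
  refine infDist_le_mul_norm_of_quadratic_growth (φ := fun x => smoothPart A c h x +
    lam * (p x).toReal) hcpt hne hκ (fun ω hω => hgrowth ω hω x hxD hxr) fun ω hω => ?_
  have h1 := hv ω
  rwa [objective_eq_coe hp A c h lam hxD, objective_eq_coe hp A c h lam (hΩD ω hω),
    ← EReal.coe_add, EReal.coe_le_coe_iff] at h1

/-- The proximal residual error bound. -/
theorem proxResidual_error_bound (hlam : 0 < lam) (hh : ConvexOn ℝ Set.univ h)
    (hhd : ContDiff ℝ 2 h) (hp : IsClosedProperConvex p)
    (hne : (minimizers (objective A c h p lam)).Nonempty)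
    (hcpt : IsCompact (minimizers (objective A c h p lam)))
    (hs : StronglyConvexOnCompacts h) (hpl : IsPiecewiseLinearQuadratic p) (ξ : ℝ) :
    ∃ κ ε : ℝ, 0 < κ ∧ 0 < ε ∧ ∀ x : EuclideanSpace ℝ (Fin n),
      objective A c h p lam x ≤ (ξ : EReal) → ‖proxResidual A c h p lam x‖ ≤ ε →
      Metric.infDist x (minimizers (objective A c h p lam)) ≤
        κ * ‖proxResidual A c h p lam x‖ := by
  have hPconv : ConvexOn ℝ {x | p x < ⊤} (fun x => lam * (p x).toReal) :=
    hp.convexOn_toReal.smul hlam.le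
  have hΦd : Differentiable ℝ (smoothPart A c h) :=
    (contDiff_smoothPart hhd).differentiable (by norm_num)
  have hφconv : ConvexOn ℝ {x | p x < ⊤}
      (fun x => smoothPart A c h x + lam * (p x).toReal) :=
    ((convexOn_smoothPart hh).subset (Set.subset_univ _) hPconv.1).add hPconv
  obtain ⟨κ₁, hκ₁, hgrowth₁⟩ := objective_quadratic_growth hlam hhd hp hne hcpt hs hpl 1
  obtain ⟨ω₀, hω₀⟩ := hne
  have hne : (minimizers (objective A c h p lam)).Nonempty := ⟨ω₀, hω₀⟩
  set Ω := minimizers (objective A c h p lam) with hΩ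
  -- Growth at radius `1` confines the sublevel set to distance `r` from `Ω`; proximal points then
  -- stay within `r + 1`, as the residual is at most `1`.
  set r := max 1 ((ξ - (smoothPart A c h ω₀ + lam * (p ω₀).toReal)) / κ₁) with hr
  obtain ⟨M, hM⟩ := (isCompact_infDist_le hcpt hne (r + 1)).isBounded.exists_norm_le
  obtain ⟨L, hL⟩ := exists_lipschitzOnWith_gradient (contDiff_smoothPart (A := A) (c := c) hhd) M
  obtain ⟨κ, hκ, hgrowth⟩ := objective_quadratic_growth hlam hhd hp hne hcpt hs hpl (r + 1)
  obtain ⟨hω₀D, hω₀min⟩ := (mem_minimizers_objective_iff hlam hp).1 hω₀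
  -- Optimality of `ω₀` supplies an affine minorant of `lam * p` with slope `-∇Φ(ω₀)`, which makes
  -- the proximal minimum attained.
  have hminor : ∀ x, p x < ⊤ → lam * (p ω₀).toReal - ⟪-gradient (smoothPart A c h) ω₀, ω₀⟫ +
      ⟪-gradient (smoothPart A c h) ω₀, x⟫ ≤ lam * (p x).toReal := fun x hx => by
    have h1 := hPconv.sub_le_of_isMinOn_add (hΦd ω₀).hasFDerivAt hω₀D hω₀min hx
    rw [← inner_gradient_left, inner_sub_right] at h1
    simp only [inner_neg_left]
    linarith
  refine ⟨κ⁻¹ * (1 + L) + 1, 1, by positivity, one_pos, fun x hxξ hR => ?_⟩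
  have hxD : p x < ⊤ := by
    by_contra hcon
    rw [objective_eq_top hlam A c h hcon, top_le_iff] at hxξ
    exact EReal.coe_ne_top _ hxξ
  rw [objective_eq_coe hp A c h lam hxD, EReal.coe_le_coe_iff] at hxξ
  have hxr : Metric.infDist x Ω ≤ r := infDist_le_of_sublevel hcpt (fun ω hω => ((mem_minimizers_objective_iff hlam hp).1 hω).1)
    hφconv hκ₁ hgrowth₁ hω₀ (fun ω hω => le_antisymm (((mem_minimizers_objective_iff hlam hp).1 hω).2 _ hω₀D)
      (hω₀min _ ((mem_minimizers_objective_iff hlam hp).1 hω).1)) hxD hxξ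
  set w := x - gradient (smoothPart A c h) x with hw
  set y := prox (fun u => (lam : EReal) * p u) w with hy
  obtain ⟨hyD, hymin⟩ := hp.prox_mem_minimizers hlam hminor w
  rw [← hy] at hyD hymin
  have hRxy : proxResidual A c h p lam x = x - y := rfl
  rw [hRxy] at hR ⊢
  have hxy : Metric.infDist y Ω ≤ Metric.infDist x Ω + ‖x - y‖ := by
    rw [← dist_eq_norm, dist_comm]
    exact Metric.infDist_le_infDist_add_dist
  have hyx : Metric.infDist x Ω ≤ Metric.infDist y Ω + ‖x - y‖ := by
    rw [← dist_eq_norm]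
    exact Metric.infDist_le_infDist_add_dist
  have hyr : Metric.infDist y Ω ≤ r + 1 := by linarith
  have hΨ : HasFDerivAt (fun u => ‖u - w‖ ^ 2 / 2) (innerSL ℝ (y - w)) y := by
    have h1 := ((hasFDerivAt_id y).sub_const w).norm_sq.mul_const (1 / 2 : ℝ)
    refine (h1.congr_fderiv ?_).congr_of_eventuallyEq
      (Filter.Eventually.of_forall fun u => by simp [div_eq_mul_inv])
    ext d
    simp
  -- Proximal optimality makes `w - y` a subgradient of `lam * p` at `y`; adding `∇Φ y` gives one of
  -- the objective. The strong convexity term is simply discarded.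
  have hsub : ∀ z, p z < ⊤ → smoothPart A c h y + lam * (p y).toReal +
      ⟪(x - y) + (gradient (smoothPart A c h) y - gradient (smoothPart A c h) x), z - y⟫ ≤
        smoothPart A c h z + lam * (p z).toReal := fun z hz => by
    have h1 := hPconv.sub_le_of_isMinOn_add hΨ hyD hymin hz
    obtain ⟨μ, hμ, h2⟩ := smoothPart_add_le (A := A) (c := c)
      (hhd.differentiable (by norm_num)) hs (max ‖z‖ ‖y‖)
    have h3 := h2 z y (le_max_left _ _) (le_max_right _ _)
    rw [← inner_gradient_left] at h3
    have h4 : 0 ≤ μ / 2 * ‖A.toEuclideanLin.toContinuousLinearMap (z - y)‖ ^ 2 := by positivity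
    have h5 : (x - y) + (gradient (smoothPart A c h) y - gradient (smoothPart A c h) x) =
        gradient (smoothPart A c h) y - (y - w) := by
      rw [hw]
      abel
    rw [h5, inner_sub_left]
    rw [innerSL_apply_apply] at h1
    linarith
  have hmain := infDist_le_mul_norm_of_quadratic_growth (φ := fun x => smoothPart A c h x +
    lam * (p x).toReal) hcpt hne hκ (fun ω hω => hgrowth ω hω y hyD hyr)
    (fun ω hω => hsub ω ((mem_minimizers_objective_iff hlam hp).1 hω).1)
  have hLip : ‖gradient (smoothPart A c h) y - gradient (smoothPart A c h) x‖ ≤ L * ‖x - y‖ := by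
    have h1 := hL.dist_le_mul y (mem_closedBall_zero_iff.2 (hM y hyr)) x
      (mem_closedBall_zero_iff.2 (hM x (by
        change Metric.infDist x Ω ≤ r + 1
        linarith)))
    rwa [dist_eq_norm, dist_comm, dist_eq_norm] at h1
  calc Metric.infDist x Ω ≤ κ⁻¹ * ‖(x - y) + (gradient (smoothPart A c h) y -
        gradient (smoothPart A c h) x)‖ + ‖x - y‖ := hyx.trans (by linarith)
    _ ≤ κ⁻¹ * (‖x - y‖ + L * ‖x - y‖) + ‖x - y‖ := by
        have := norm_add_le (x - y)
          (gradient (smoothPart A c h) y - gradient (smoothPart A c h) x)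
        gcongr
        linarith
    _ = (κ⁻¹ * (1 + L) + 1) * ‖x - y‖ := by ring

end

/-! ### Regression losses. -/

/-- A separable sum of strongly convex functions of one variable is strongly convex. -/
theorem strongConvexOn_sum_apply {m : ℕ} {D : Set ℝ} {μ : ℝ} {φ : Fin m → ℝ → ℝ}
    (hφ : ∀ i, StrongConvexOn D μ (φ i)) {K : Set (EuclideanSpace ℝ (Fin m))} (hK : Convex ℝ K)
    (hKD : ∀ y ∈ K, ∀ i, y i ∈ D) : StrongConvexOn K μ fun y => ∑ i, φ i (y i) := by
  refine ⟨hK, fun x hx y hy a b ha hb hab => ?_⟩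
  have h1 : ∀ i, φ i ((a • x + b • y) i) ≤
      a * φ i (x i) + b * φ i (y i) - a * b * (μ / 2 * (x i - y i) ^ 2) := fun i => by
    have := (hφ i).2 (hKD x hx i) (hKD y hy i) ha hb hab
    simpa [sq_abs] using this
  refine (Finset.sum_le_sum fun i _ => h1 i).trans_eq ?_
  dsimp only
  rw [EuclideanSpace.real_norm_sq_eq, Finset.sum_sub_distrib, Finset.sum_add_distrib]
  simp only [← Finset.mul_sum, smul_eq_mul, PiLp.sub_apply]

/-- A compact set has all coordinates in some `[-M, M]`, so a modulus on that interval common to all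
summands suffices. -/
theorem stronglyConvexOnCompacts_sum_apply {m : ℕ} {φ : Fin m → ℝ → ℝ}
    (hφ : ∀ M : ℝ, ∃ μ : ℝ, 0 < μ ∧ ∀ i, StrongConvexOn (Set.Icc (-M) M) μ (φ i)) :
    StronglyConvexOnCompacts fun y : EuclideanSpace ℝ (Fin m) => ∑ i, φ i (y i) := by
  intro K hKc hK
  obtain ⟨M, hM⟩ := hKc.isBounded.exists_norm_le
  obtain ⟨μ, hμ, h⟩ := hφ M
  exact ⟨μ, hμ, strongConvexOn_sum_apply h hK fun y hy i =>
    abs_le.1 ((PiLp.norm_apply_le y i).trans (hM y hy))⟩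

theorem convexOn_sum_apply {m : ℕ} {φ : Fin m → ℝ → ℝ}
    (hφ : ∀ i, ConvexOn ℝ Set.univ (φ i)) :
    ConvexOn ℝ Set.univ fun y : EuclideanSpace ℝ (Fin m) => ∑ i, φ i (y i) := by
  rw [← strongConvexOn_zero]
  exact strongConvexOn_sum_apply (fun i => strongConvexOn_zero.2 (hφ i)) convex_univ
    fun _ _ _ => Set.mem_univ _

theorem strongConvexOn_sq_sub_div_two (b : ℝ) {D : Set ℝ} (hD : Convex ℝ D) :
    StrongConvexOn D 1 fun t => (t - b) ^ 2 / 2 := by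
  refine ⟨hD, fun x _ y _ s t _ _ hst => le_of_eq ?_⟩
  obtain rfl : t = 1 - s := by linarith
  simp only [smul_eq_mul, Real.norm_eq_abs, sq_abs]
  ring

theorem linearLoss_assumptions {m : ℕ} (b : Fin m → ℝ) :
    ConvexOn ℝ Set.univ (linearLoss b) ∧ ContDiff ℝ 2 (linearLoss b) ∧
      StronglyConvexOnCompacts (linearLoss b) := by
  refine ⟨convexOn_sum_apply fun i => (strongConvexOn_sq_sub_div_two (b i) convex_univ).convexOn
    fun r => by positivity, ?_, stronglyConvexOnCompacts_sum_apply fun M =>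
      ⟨1, one_pos, fun i => strongConvexOn_sq_sub_div_two (b i) (convex_Icc _ _)⟩⟩
  unfold linearLoss
  fun_prop

/-- Strong convexity of the one-dimensional logistic loss, from a lower bound on its second
derivative. -/
theorem strongConvexOn_log_one_add_exp {b μ : ℝ} {D : Set ℝ} (hD : Convex ℝ D)
    (hμ : ∀ t ∈ D, μ ≤ b ^ 2 * (Real.exp (-(b * t)) / (1 + Real.exp (-(b * t))) ^ 2)) :
    StrongConvexOn D μ fun t => Real.log (1 + Real.exp (-(b * t))) := by
  rw [strongConvexOn_iff_convex]
  have hpos : ∀ t : ℝ, 0 < 1 + Real.exp (-(b * t)) := fun t => by positivity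
  have he : ∀ t : ℝ, HasDerivAt (fun t => Real.exp (-(b * t))) (Real.exp (-(b * t)) * -b) t :=
    fun t => by
      have := ((hasDerivAt_id t).const_mul b).neg.exp
      simpa using! this
  have h1 : ∀ t, HasDerivAt (fun t => Real.log (1 + Real.exp (-(b * t))) - μ / 2 * ‖t‖ ^ 2)
      (Real.exp (-(b * t)) * -b / (1 + Real.exp (-(b * t))) - μ * t) t := fun t => by
    simp only [Real.norm_eq_abs, sq_abs]
    have := (((he t).const_add 1).log (hpos t).ne').sub
      (((hasDerivAt_id t).pow 2).const_mul (μ / 2))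
    refine this.congr_deriv ?_
    simp only [id_eq]
    ring
  have h2 : ∀ t, HasDerivAt
      (fun t => Real.exp (-(b * t)) * -b / (1 + Real.exp (-(b * t))) - μ * t)
      (b ^ 2 * (Real.exp (-(b * t)) / (1 + Real.exp (-(b * t))) ^ 2) - μ) t := fun t => by
    have := (((he t).mul_const (-b)).div ((he t).const_add 1) (hpos t).ne').sub
      ((hasDerivAt_id t).const_mul μ)
    refine this.congr_deriv ?_
    have := (hpos t).ne'
    field_simp
    ring
  refine convexOn_of_hasDerivWithinAt2_nonneg hD
    (continuous_iff_continuousAt.2 fun t => (h1 t).continuousAt).continuousOn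
    (fun t _ => (h1 t).hasDerivWithinAt) (fun t _ => (h2 t).hasDerivWithinAt) fun t ht => ?_
  exact sub_nonneg.2 (hμ t (interior_subset ht))

theorem logisticLoss_assumptions {m : ℕ} {b : Fin m → ℝ} (hb : ∀ i, b i = -1 ∨ b i = 1) :
    ConvexOn ℝ Set.univ (logisticLoss b) ∧ ContDiff ℝ 2 (logisticLoss b) ∧
      StronglyConvexOnCompacts (logisticLoss b) := by
  -- Convexity is the case of modulus `0`. On `[-M, M]` the exponent is between `-M` and `M`, so
  -- bounding numerator and denominator of the second derivative separately gives the modulus.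
  refine ⟨convexOn_sum_apply fun i => strongConvexOn_zero.1
    (strongConvexOn_log_one_add_exp convex_univ fun t _ => by positivity), ?_,
    stronglyConvexOnCompacts_sum_apply fun M => ⟨Real.exp (-M) / (1 + Real.exp M) ^ 2,
      by positivity, fun i => strongConvexOn_log_one_add_exp (convex_Icc _ _) fun t ht => ?_⟩⟩
  · unfold logisticLoss
    refine ContDiff.sum fun i _ => ContDiff.log (by fun_prop) fun y => ?_
    positivity
  · have hsq : b i ^ 2 = 1 := by rcases hb i with h | h <;> rw [h] <;> norm_num
    have h1 : -M ≤ -(b i * t) ∧ -(b i * t) ≤ M := by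
      rcases hb i with h | h <;> rw [h] <;> constructor <;> linarith [ht.1, ht.2]
    rw [hsq, one_mul]
    gcongr
    · linarith [h1.1]
    · linarith [h1.2]

/-! ### The exclusive lasso regularizer. -/

section ExclusiveLasso

variable {n l : ℕ} (g : Fin l → Finset (Fin n)) (w : Fin n → ℝ)

theorem continuous_exclusiveLasso : Continuous (exclusiveLasso g w) := by
  unfold exclusiveLasso
  fun_prop

theorem convexOn_exclusiveLasso : ConvexOn ℝ Set.univ (exclusiveLasso g w) := by
  have h1 : ∀ j, ConvexOn ℝ Set.univ
      (fun x : EuclideanSpace ℝ (Fin n) => ∑ i ∈ g j, |w i * x i|) := fun j => by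
    refine ⟨convex_univ, fun x _ y _ a b ha hb _ => ?_⟩
    simp only [smul_eq_mul, Finset.mul_sum, ← Finset.sum_add_distrib]
    refine Finset.sum_le_sum fun i _ => ?_
    rw [← abs_of_nonneg ha, ← abs_of_nonneg hb, ← abs_mul, ← abs_mul, abs_of_nonneg ha,
      abs_of_nonneg hb]
    refine le_of_eq_of_le ?_ (abs_add_le _ _)
    congr 1
    simp only [PiLp.add_apply, PiLp.smul_apply, smul_eq_mul]
    ring
  have h2 : ∀ j, ConvexOn ℝ Set.univ
      (fun x : EuclideanSpace ℝ (Fin n) => (∑ i ∈ g j, |w i * x i|) ^ 2) := fun j =>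
    (h1 j).pow (fun x _ => Finset.sum_nonneg fun i _ => abs_nonneg _) 2
  refine ⟨convex_univ, fun x hx y hy a b ha hb hab => ?_⟩
  simp only [exclusiveLasso, smul_eq_mul, Finset.mul_sum, ← Finset.sum_add_distrib]
  exact Finset.sum_le_sum fun j _ => (h2 j).2 hx hy ha hb hab

theorem isClosedProperConvex_exclusiveLasso :
    IsClosedProperConvex (fun x => (exclusiveLasso g w x : EReal)) where
  ne_bot _ := EReal.coe_ne_bot _
  exists_ne_top := ⟨0, EReal.coe_ne_top _⟩
  closed := (continuous_coe_real_ereal.comp (continuous_exclusiveLasso g w)).lowerSemicontinuous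
  convex := by
    simpa [EReal.coe_le_coe_iff] using (convexOn_exclusiveLasso g w).convex_epigraph

theorem inner_vecMulVec_self (u : Fin n → ℝ) (x : EuclideanSpace ℝ (Fin n)) :
    ⟪x, (Matrix.vecMulVec u u).toEuclideanLin x⟫ = (∑ i, u i * x i) ^ 2 := by
  rw [Matrix.toLpLin_apply, Matrix.vecMulVec_mulVec, PiLp.inner_apply]
  simp only [dotProduct, Pi.smul_apply, MulOpposite.smul_eq_mul_unop, MulOpposite.unop_op,
    RCLike.inner_apply, conj_trivial, sq, Finset.mul_sum, Finset.sum_mul]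
  rw [Finset.sum_comm]
  refine Finset.sum_congr rfl fun i _ => Finset.sum_congr rfl fun k _ => ?_
  ring

/-- The pieces are the closed orthants, one per sign pattern. On each, every absolute value is
linear, so a group contributes the square of a linear form, a rank-one quadratic. -/
theorem isPiecewiseLinearQuadratic_exclusiveLasso (hw : ∀ i, 0 < w i) :
    IsPiecewiseLinearQuadratic (fun x => (exclusiveLasso g w x : EReal)) := by
  classical
  set e := Fintype.equivFin (Fin n → Bool) with he
  set s : (Fin n → Bool) → Fin n → ℝ := fun σ i => if σ i then 1 else -1 with hs
  refine ⟨_, fun k => {x | ∀ i, 0 ≤ s (e.symm k) i * x i}, fun k => ?_, ?_, fun k => ?_⟩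
  · refine ⟨n, fun i => EuclideanSpace.single i (-s (e.symm k) i), fun _ => 0, ?_⟩
    ext x
    simp [EuclideanSpace.inner_single_left]
  · ext x
    simp only [EReal.coe_lt_top, Set.mem_ofPred_eq, Set.mem_iUnion, true_iff]
    refine ⟨e fun i => decide (0 ≤ x i), fun i => ?_⟩
    by_cases hx : 0 ≤ x i
    · simp [hs, hx]
    · simpa [hs, hx] using (not_le.1 hx).le
  · set σ := e.symm k
    set u : Fin l → Fin n → ℝ := fun j i => if i ∈ g j then s σ i * w i else 0 with hu
    -- The factor `2` cancels the one half in the quadratic normal form.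
    refine ⟨(2 : ℝ) • ∑ j, Matrix.vecMulVec (u j) (u j), 0, 0, ?_, fun x hx => ?_⟩
    · refine Matrix.IsSymm.smul ?_ _
      rw [Matrix.IsSymm, Matrix.transpose_sum]
      exact Finset.sum_congr rfl fun j _ => Matrix.transpose_vecMulVec _ _
    · rw [EReal.coe_eq_coe_iff, map_smul, map_sum, LinearMap.smul_apply, LinearMap.sum_apply,
        real_inner_smul_right, inner_sum, inner_zero_left, exclusiveLasso]
      simp only [inner_vecMulVec_self]
      have habs : ∀ i, |w i * x i| = s σ i * w i * x i := fun i => by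
        have h1 : s σ i * x i = |x i| := by
          have h2 := hx i
          have h3 : |s σ i| = 1 := by
            simp only [hs]
            split_ifs <;> simp
          rw [← abs_of_nonneg h2, abs_mul, h3, one_mul]
        rw [abs_mul, abs_of_pos (hw i), ← h1]
        ring
      have hsum : ∀ j, ∑ i, u j i * x i = ∑ i ∈ g j, |w i * x i| := fun j => by
        simp only [hu, ite_mul, zero_mul, habs]
        rw [← Finset.sum_filter]
        simp
      simp only [hsum]
      ring

end ExclusiveLasso

theorem proposition3p3 :
    (∀ (m n : ℕ) (A : Matrix (Fin m) (Fin n) ℝ) (c : EuclideanSpace ℝ (Fin n))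
      (h : EuclideanSpace ℝ (Fin m) → ℝ) (p : EuclideanSpace ℝ (Fin n) → EReal) (lam : ℝ),
      0 < lam → ConvexOn ℝ Set.univ h → ContDiff ℝ 2 h → IsClosedProperConvex p →
      (minimizers (objective A c h p lam)).Nonempty →
      IsCompact (minimizers (objective A c h p lam)) →
      StronglyConvexOnCompacts h → IsPiecewiseLinearQuadratic p →
      (∀ ξ : ℝ, (⨅ x, objective A c h p lam x) ≤ (ξ : EReal) →
        ∃ κ ε : ℝ, 0 < κ ∧ 0 < ε ∧ ∀ x : EuclideanSpace ℝ (Fin n),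
          objective A c h p lam x ≤ (ξ : EReal) → ‖proxResidual A c h p lam x‖ ≤ ε →
          Metric.infDist x (minimizers (objective A c h p lam)) ≤
            κ * ‖proxResidual A c h p lam x‖) ∧
      ErrorBoundCondition (objective A c h p lam)) ∧
    (∀ (m : ℕ) (b : Fin m → ℝ),
      ConvexOn ℝ Set.univ (linearLoss b) ∧ ContDiff ℝ 2 (linearLoss b) ∧
      StronglyConvexOnCompacts (linearLoss b)) ∧
    (∀ (m : ℕ) (b : Fin m → ℝ), (∀ i, b i = -1 ∨ b i = 1) →
      ConvexOn ℝ Set.univ (logisticLoss b) ∧ ContDiff ℝ 2 (logisticLoss b) ∧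
      StronglyConvexOnCompacts (logisticLoss b)) ∧
    (∀ (n l : ℕ) (g : Fin l → Finset (Fin n)) (w : Fin n → ℝ),
      (∀ j k, j ≠ k → Disjoint (g j) (g k)) → (∀ i, ∃ j, i ∈ g j) → (∀ i, 0 < w i) →
      IsClosedProperConvex (fun x => (exclusiveLasso g w x : EReal)) ∧
      IsPiecewiseLinearQuadratic (fun x => (exclusiveLasso g w x : EReal))) := by
  refine ⟨fun m n A c h p lam hlam hh hhd hp hne hcpt hs hpl => ⟨fun ξ _ =>
    proxResidual_error_bound hlam hh hhd hp hne hcpt hs hpl ξ,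
    errorBoundCondition_objective hlam hhd hp hne hcpt hs hpl⟩,
    fun m b => linearLoss_assumptions b, fun m b hb => logisticLoss_assumptions hb,
    fun n l g w _ _ hw => ⟨isClosedProperConvex_exclusiveLasso g w,
      isPiecewiseLinearQuadratic_exclusiveLasso g w hw⟩⟩
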